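/- A partition $\pi$ of $n$ ($\pi\vdash n$) has rank equal to its largest part minus its number of parts; its crank is its largest part if $1$ is not a part, and otherwise it is the number of parts larger than $w$ minus $w$, where $w$ is the number of ones in $\pi$. Let $N(m,n)$ be the number of partitions of $n$ with rank $m$, and for $n\ne 1$ let $M(m,n)$ be the number of partitions of $n$ with crank $m$; for $n=1$ put $M(-1,1)=M(1,1)=1$, $M(0,1)=-1$, and $M(m,1)=0$ otherwise. The symmetrized rank and crank moments are $$\eta_k(n)=\sum_{m=-n}^{n}\binom{m+\lfloor\frac{k-1}{2}\rfloor}{k}N(m,n),\qquad \mu_k(n)=\sum_{m=-n}^{n}\binom{m+\lfloor\frac{k-1}{2}\rfloor}{k}M(m,n),$$ where $\binom{x}{k}=x(x-1)\cdots(x-k+1)/k!$ for every integer $x$. If the different parts of $\pi$ are $n_1<n_2<\cdots<n_m$, let $f_j=f_j(\pi)$ be the number of times the part $n_j$ occurs in $\pi$ ($1\le j\le m$). For $k\ge 1$ and $n\ge 1$ define $$\omega_k(\pi)=\sum_{m_1+m_2+\cdots+m_r=k}\binom{f_1+m_1-1}{2m_1-1}\sum_{2\le j_2<j_3<\cdots<j_r\le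 m}\binom{f_{j_2}+m_2}{2m_2}\binom{f_{j_3}+m_3}{2m_3}\cdots\binom{f_{j_r}+m_r}{2m_r},\qquad \mathrm{spt}_k(n)=\sum_{\pi\vdash n}\omega_k(\pi),$$ where the outer sum is over all compositions $m_1+\cdots+m_r$ of $k$ into positive integers ($1\le r\le k$), and the inner sum is $1$ when $r=1$. Theorem. For all integers $k\ge 1$ and $n\ge 1$, $$\mathrm{spt}_k(n)=\mu_{2k}(n)-\eta_{2k}(n).$$ -/

import Mathlib

namespace SptMoments

/-- The largest part of a partition (`0` for the empty partition). -/
def largestPart {n : ℕ} (p : n.Partition) : ℕ := p.parts.sup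

/-- The rank of a partition: its largest part minus its number of parts. -/
def rank {n : ℕ} (p : n.Partition) : ℤ :=
  (largestPart p : ℤ) - (Multiset.card p.parts : ℤ)

/-- The crank of a partition (Andrews and Garvan): the largest part if `1` is not a part; otherwise
the number of parts that are larger than the number of ones, minus the number of ones. -/
def crank {n : ℕ} (p : n.Partition) : ℤ :=
  if p.parts.count 1 = 0 then (largestPart p : ℤ)
  else (Multiset.card (p.parts.filter (fun a => p.parts.count 1 < a)) : ℤ)
    - (p.parts.count 1 : ℤ)

/-- `N(m, n)`: the number of partitions of `n` with rank `m`. -/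
def rankCount (m : ℤ) (n : ℕ) : ℤ :=
  ((Finset.univ.filter (fun p : n.Partition => rank p = m)).card : ℤ)

/-- `M(m, n)`: the number of partitions of `n` with crank `m` for `n ≠ 1`, with the customary
convention `M(-1, 1) = 1`, `M(0, 1) = -1`, `M(1, 1) = 1`, and `M(m, 1) = 0` otherwise. -/
def crankCount (m : ℤ) (n : ℕ) : ℤ :=
  if n = 1 then
    (if m = -1 then 1 else if m = 0 then -1 else if m = 1 then 1 else 0)
  else ((Finset.univ.filter (fun p : n.Partition => crank p = m)).card : ℤ)

/-- The symmetrized rank moment `η_k(n) = ∑_{m=-n}^{n} binom(m + ⌊(k-1)/2⌋, k) N(m, n)`.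
Here `Ring.choose` on `ℤ` is `x (x-1) ⋯ (x-k+1) / k!`, also for negative `x`, and division of
integers by `2` rounds down. -/
noncomputable def eta (k n : ℕ) : ℤ :=
  ∑ m ∈ Finset.Icc (-(n : ℤ)) (n : ℤ), Ring.choose (m + ((k : ℤ) - 1) / 2) k * rankCount m n

/-- The symmetrized crank moment `μ_k(n) = ∑_{m=-n}^{n} binom(m + ⌊(k-1)/2⌋, k) M(m, n)`. -/
noncomputable def mu (k n : ℕ) : ℤ :=
  ∑ m ∈ Finset.Icc (-(n : ℤ)) (n : ℤ), Ring.choose (m + ((k : ℤ) - 1) / 2) k * crankCount m n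

/-- The number of different parts of a partition. -/
def numDistinct {n : ℕ} (p : n.Partition) : ℕ := p.parts.toFinset.card

/-- The `j`-th smallest of the different parts `n_1 < n_2 < ⋯` of a partition, for
`1 ≤ j ≤ numDistinct p`. -/
def distinctPart {n : ℕ} (p : n.Partition) (j : ℕ) : ℕ :=
  (p.parts.toFinset.sort (· ≤ ·)).getD (j - 1) 0

/-- `f_j`: the frequency (multiplicity) of the part `n_j`, for `1 ≤ j ≤ numDistinct p`. -/
def freq {n : ℕ} (p : n.Partition) (j : ℕ) : ℕ := p.parts.count (distinctPart p j)

/-- The `i`-th summand `m_i` of a composition `m_1 + ⋯ + m_r = k`, for `1 ≤ i ≤ r`. -/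
def summand {k : ℕ} (c : Composition k) (i : ℕ) : ℕ := c.blocks.getD (i - 1) 0

/-- The tuples of indices `2 ≤ j_2 < j_3 < ⋯ < j_r ≤ m`, where `j_{i+2}` is the value at
`i : Fin (r - 1)`. For `r = 1` there is exactly one, the empty tuple. -/
def indexTuples (r m : ℕ) : Finset (Fin (r - 1) → ℕ) :=
  (Fintype.piFinset (fun _ : Fin (r - 1) => Finset.Icc 2 m)).filter
    (fun j => ∀ a b : Fin (r - 1), a < b → j a < j b)

/-- The weight `ω_k(π)` (for `k ≥ 1` and a non-empty partition `π`): the sum over all compositions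
`m_1 + ⋯ + m_r = k` of
`binom(f_1 + m_1 - 1, 2 m_1 - 1) ∑_{2 ≤ j_2 < ⋯ < j_r} ∏_{i=2}^{r} binom(f_{j_i} + m_i, 2 m_i)`. -/
def omega (k : ℕ) {n : ℕ} (p : n.Partition) : ℕ :=
  ∑ c : Composition k,
    (freq p 1 + summand c 1 - 1).choose (2 * summand c 1 - 1) *
      ∑ j ∈ indexTuples c.length (numDistinct p),
        ∏ i : Fin (c.length - 1),
          (freq p (j i) + summand c ((i : ℕ) + 2)).choose (2 * summand c ((i : ℕ) + 2))

/-- The higher order spt-function `spt_k(n) = ∑_{π ⊢ n} ω_k(π)`. -/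
def spt (k n : ℕ) : ℕ := ∑ p : n.Partition, omega k p

end SptMoments

/-! The identity is proved with generating functions in q, a second variable s marking k. Write P
for the partition series, (q)_n = (1-q)⋯(1-q^n), and E_i, O_i for the sums over f of q^(if) times
`evenWeight f`, `oddWeight f`. In double power series the outer `X` is q and the inner one, seen as
`C X`, is s.

Spt side. ω_k is the coefficient of s^k in a product with an O-type weight at the smallest part and
E-type weights at the larger ones, so the partitions with parts at most N contribute S_N = ∑_n O_n
∏_{n<j≤N} E_j. Both weights satisfy a(f+2) = (2+s) a(f+1) - a(f). Hence E_i = (1-q^i)/B_i and O_i =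
s q^i/B_i, where B_i = (1-q^i)^2 - s q^i. The core is `sptSeries_eq_sum`: S_N = ∑_{r≥1} α_r
(q)_N/((q)_{N-r} (q)_{N+r}) O_r, with α_r = (-1)^(r-1) (q^(r(r-1)/2) - q^(r(3r-1)/2)) (1+q^r). It
follows by induction from S_{N+1} = S_N E_{N+1} + O_{N+1}, from B_{N+1} = (1-q^(N+1-r))(1-q^(N+1+r))
+ q^(N+1-r) B_r, and from `sum_baileyAlpha`, which says that the same sum without the O_r equals 1.
The latter is the difference of two classical Bailey pairs, β_N = 1/(q)_N and the unit pair. As N →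
∞, S_N tends to P ∑ α_r O_r.

Moment side. Summation by parts turns a symmetrized moment into a sum over r of tail counts G_r with
weights binom(r+k-1, 2k-1) + binom(r+k-2, 2k-1). The tails satisfy G_r = q^r (P - G_{r+1}) for the
crank (Durfee rectangles) and G_r = q^(r+1) (P - G_{r+3}) for the rank (Dyson's map). Iterating
gives alternating series in which the crank has exponents r(r-1)/2 and the rank r(3r-1)/2. Their
difference is the spt series, because α_r contains exactly these two terms. -/

namespace SptMoments

open Finset PowerSeries

/-! ### Weights multiplicative in the frequencies, as Euler products -/

section PartSeries

variable {R : Type*} [CommRing R]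

/-- The power series `∑ c, a c * X ^ (i * c)`. -/
noncomputable def partSeries (i : ℕ) (a : ℕ → R) : R⟦X⟧ :=
  PowerSeries.mk fun m => if i ∣ m then a (m / i) else 0

/-- Dividing the i-th entry by i recovers the frequency of the part i. -/
theorem exists_partition_of_dvd {n N : ℕ} {g : ℕ →₀ ℕ} (hg : g ∈ (Icc 1 N).finsuppAntidiag n)
    (hd : ∀ i ∈ Icc 1 N, i ∣ g i) :
    ∃ p : n.Partition, p.toFinsuppAntidiag = g := by
  obtain ⟨h1, h2⟩ := mem_finsuppAntidiag.mp hg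
  have hpos : ∀ i, g i ≠ 0 → i ∈ Icc 1 N := fun i hi => h2 (by simpa using hi)
  have hdvd : ∀ i, i ∣ g i := by
    intro i
    by_cases hi : g i = 0
    · simp [hi]
    · exact hd i (hpos i hi)
  refine ⟨Nat.Partition.mk (Finsupp.mk g.support (fun i ↦ g i / i) ?_).toMultiset ?_ ?_, ?_⟩
  · intro i
    simp only [Finsupp.mem_support_iff]
    constructor
    · intro h h'
      have := Nat.div_mul_cancel (hdvd i)
      rw [h'] at this
      omega
    · intro h h'
      simp [h'] at h
  · intro i hi
    have : g i ≠ 0 := by simpa using hi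
    exact (mem_Icc.mp (hpos i this)).1
  · refine Eq.trans ?_ h1
    suffices ∑ x ∈ g.support, g x / x * x = ∑ x ∈ Icc 1 N, g x by simpa [Finsupp.sum]
    apply sum_subset_zero_on_sdiff h2 (by simp)
    exact fun x _ ↦ Nat.div_mul_cancel (hdvd x)
  · ext x
    simpa [Nat.Partition.toFinsuppAntidiag] using Nat.div_mul_cancel (hdvd x)

/-- A sum over the partitions of `n` of weights that are multiplicative in the frequencies is a
coefficient of a finite product. -/
theorem sum_prod_count_eq_coeff (φ : ℕ → ℕ → R) {n N : ℕ} (h : n ≤ N) :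
    ∑ p : n.Partition, ∏ i ∈ Icc 1 N, φ i (p.parts.count i) =
      coeff n (∏ i ∈ Icc 1 N, partSeries i (φ i)) := by
  rw [coeff_prod]
  refine sum_of_injOn Nat.Partition.toFinsuppAntidiag
    (Nat.Partition.toFinsuppAntidiag_injective n).injOn ?_ ?_ ?_
  · intro p _
    exact finsuppAntidiag_mono (Icc_subset_Icc_right h) _
      p.toFinsuppAntidiag_mem_finsuppAntidiag
  -- A tuple that comes from no partition has an entry not divisible by its index, so its term
  -- vanishes.
  · intro g hg hg'
    by_contra hne
    apply hg'
    obtain ⟨p, hp⟩ := exists_partition_of_dvd hg (by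
      intro i hi
      by_contra hdi
      exact hne (prod_eq_zero hi (by simp [partSeries, hdi])))
    exact ⟨p, by simp, hp⟩
  · intro p _
    refine prod_congr rfl fun i hi => ?_
    have hi0 : 0 < i := (mem_Icc.mp hi).1
    simp [partSeries, Nat.Partition.toFinsuppAntidiag, hi0]

theorem coeff_partSeries (i m : ℕ) (a : ℕ → R) :
    coeff m (partSeries i a) = if i ∣ m then a (m / i) else 0 := by
  simp [partSeries]

/-- The shifted sequence `0, a 0, a 1, …`. -/
def shiftSeq (a : ℕ → R) : ℕ → R := fun c => if c = 0 then 0 else a (c - 1)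

theorem X_pow_mul_partSeries {i : ℕ} (hi : 0 < i) (a : ℕ → R) :
    X ^ i * partSeries i a = partSeries i (shiftSeq a) := by
  ext m
  rw [coeff_X_pow_mul', coeff_partSeries i m (shiftSeq a)]
  split_ifs with h1 h2 h2
  · obtain ⟨c, rfl⟩ := h2
    have hc : c ≠ 0 := by rintro rfl; simp at h1; omega
    obtain ⟨c, rfl⟩ := Nat.exists_eq_succ_of_ne_zero hc
    rw [coeff_partSeries, show i * c.succ - i = i * c by rw [Nat.mul_succ]; omega]
    simp [shiftSeq, hi]
  · rw [coeff_partSeries, if_neg]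
    intro h3
    exact h2 ((Nat.dvd_sub_iff_left h1 dvd_rfl).mp h3)
  · obtain ⟨c, rfl⟩ := h2
    have hc : c = 0 := by
      by_contra hc
      exact h1 (Nat.le_mul_of_pos_right i (Nat.pos_of_ne_zero hc))
    simp [hc, shiftSeq]
  · rfl

theorem partSeries_add (i : ℕ) (a b : ℕ → R) :
    partSeries i a + partSeries i b = partSeries i (fun c => a c + b c) := by
  ext m
  simp only [map_add, coeff_partSeries]
  split_ifs <;> simp

theorem partSeries_sub (i : ℕ) (a b : ℕ → R) :
    partSeries i a - partSeries i b = partSeries i (fun c => a c - b c) := by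
  ext m
  simp only [map_sub, coeff_partSeries]
  split_ifs <;> simp

theorem C_mul_partSeries (i : ℕ) (r : R) (a : ℕ → R) :
    C r * partSeries i a = partSeries i (fun c => r * a c) := by
  ext m
  simp only [coeff_C_mul, coeff_partSeries]
  split_ifs <;> simp

theorem partSeries_single {i : ℕ} (hi : 0 < i) (w : ℕ) (r : R) :
    partSeries i (fun c => if c = w then r else 0) = C r * X ^ (i * w) := by
  ext m
  rw [coeff_C_mul, coeff_X_pow, coeff_partSeries]
  by_cases h : i ∣ m
  · obtain ⟨c, rfl⟩ := h
    have : i * c = i * w ↔ c = w := by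
      constructor
      · exact fun h => Nat.eq_of_mul_eq_mul_left hi h
      · rintro rfl; rfl
    simp [hi, this]
  · have : m ≠ i * w := by rintro rfl; simp at h
    simp [h, this]

theorem partSeries_zero_indicator {i : ℕ} (hi : 0 < i) :
    partSeries i (fun c => if c = 0 then (1 : R) else 0) = 1 := by
  rw [partSeries_single hi]
  simp

theorem partSeries_pow_mul {i : ℕ} (hi : 0 < i) (z : R) :
    (1 - C z * X ^ i) * partSeries i (fun c => z ^ c) = 1 := by
  rw [sub_mul, one_mul, mul_assoc, X_pow_mul_partSeries hi, C_mul_partSeries, partSeries_sub,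
    ← partSeries_zero_indicator hi]
  congr 1
  ext c
  rcases c with _ | c
  · simp [shiftSeq]
  · simp [shiftSeq, pow_succ']

theorem one_sub_X_pow_mul_partSeries {i : ℕ} (hi : 0 < i) :
    (1 - X ^ i) * partSeries i (fun _ => (1 : R)) = 1 := by
  simpa using partSeries_pow_mul hi (1 : R)

theorem X_pow_dvd_partSeries {i : ℕ} {a : ℕ → R} (h0 : a 0 = 0) : X ^ i ∣ partSeries i a := by
  rw [X_pow_dvd_iff]
  intro m hm
  rw [coeff_partSeries]
  split_ifs with h
  · obtain rfl : m = 0 := Nat.eq_zero_of_dvd_of_lt h hm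
    simp [h0]
  · rfl

theorem coeff_eq_of_X_pow_dvd_sub {f g : R⟦X⟧} {m n : ℕ} (h : X ^ m ∣ f - g) (hn : n < m) :
    coeff n f = coeff n g := by
  rw [X_pow_dvd_iff] at h
  simpa [sub_eq_zero] using h n hn

/-- The product `(1 - q) (1 - q ^ 2) ⋯ (1 - q ^ n)`, where `q` is the variable. -/
noncomputable def qPoch (R : Type*) [CommRing R] (n : ℕ) : R⟦X⟧ :=
  ∏ i ∈ range n, (1 - X ^ (i + 1))

/-- The inverse of `qPoch R n`. -/
noncomputable def qInv (R : Type*) [CommRing R] (n : ℕ) : R⟦X⟧ :=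
  ∏ i ∈ range n, partSeries (i + 1) (fun _ => 1)

@[simp] theorem qPoch_zero : qPoch R 0 = 1 := by simp [qPoch]

@[simp] theorem qInv_zero : qInv R 0 = 1 := by simp [qInv]

theorem qPoch_succ (n : ℕ) : qPoch R (n + 1) = qPoch R n * (1 - X ^ (n + 1)) := by
  simp [qPoch, prod_range_succ]

theorem one_sub_mul_qInv_succ (n : ℕ) : (1 - X ^ (n + 1)) * qInv R (n + 1) = qInv R n := by
  rw [qInv, prod_range_succ, mul_left_comm, one_sub_X_pow_mul_partSeries n.succ_pos, mul_one, qInv]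

theorem qPoch_mul_qInv (n : ℕ) : qPoch R n * qInv R n = 1 := by
  induction n with
  | zero => simp
  | succ n ih => rw [qPoch_succ, mul_assoc, one_sub_mul_qInv_succ, ih]

/-- Passing from n to n + 1 adds X^(n+1)/(q)_{n+1}, which does not affect degrees at most n. -/
theorem X_pow_dvd_qInv_sub {m n : ℕ} (h : m ≤ n) :
    X ^ (m + 1) ∣ qInv R n - qInv R m := by
  induction n, h using Nat.le_induction with
  | base => simp
  | succ n hmn ih =>
    have : qInv R (n + 1) - qInv R m = X ^ (n + 1) * qInv R (n + 1) + (qInv R n - qInv R m) := by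
      rw [← one_sub_mul_qInv_succ n]; ring
    rw [this]
    exact dvd_add (Dvd.dvd.mul_right (pow_dvd_pow _ (by omega)) _) ih

theorem qInv_eq_prod_Icc (n : ℕ) :
    qInv R n = ∏ i ∈ Icc 1 n, partSeries i (fun _ => 1) := by
  rw [qInv, Finset.range_eq_Ico, Finset.prod_Ico_add' (fun i => partSeries i fun _ => (1 : R)) 0 n 1]
  rfl

/-- The generating function of the number of partitions. -/
noncomputable def partitionSeries (R : Type*) [CommRing R] : R⟦X⟧ :=
  PowerSeries.mk fun n => (Fintype.card n.Partition : R)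

theorem coeff_partitionSeries {n N : ℕ} (h : n ≤ N) :
    coeff n (partitionSeries R) = coeff n (qInv R N) := by
  rw [qInv_eq_prod_Icc, ← sum_prod_count_eq_coeff _ h]
  simp [partitionSeries]

theorem X_pow_dvd_partitionSeries_sub (N : ℕ) :
    X ^ (N + 1) ∣ partitionSeries R - qInv R N := by
  rw [X_pow_dvd_iff]
  intro m hm
  rw [map_sub, coeff_partitionSeries (by omega : m ≤ N), sub_self]

end PartSeries

/-! ### Two finite Bailey pair identities and their difference -/

section Bailey

variable {R : Type*} [CommRing R]

theorem choose_two_succ (r : ℕ) : (r + 2).choose 2 = (r + 1).choose 2 + (r + 1) := by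
  rw [Nat.choose_succ_succ' (r + 1) 1, Nat.choose_one_right, add_comm]

/-- A finite form of the orthogonality relation for the unit Bailey pair. -/
theorem one_sub_mul_sum_unit_pair (N M : ℕ) (hM : M ≤ N) :
    (1 - X ^ N) * ∑ r ∈ range M, (-1) ^ r * X ^ ((r + 1).choose 2) * (1 + X ^ (r + 1)) *
        (qInv R (N - (r + 1)) * qInv R (N + (r + 1))) =
      (1 - X ^ N) * (qInv R N * qInv R N) -
        (-1) ^ M * X ^ ((M + 1).choose 2) * (1 - X ^ (N - M)) *
          (qInv R (N - M) * qInv R (N + M)) := by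
  induction M with
  | zero => simp
  | succ M ih =>
    obtain ⟨t, rfl⟩ := Nat.exists_eq_add_of_le hM
    rw [sum_range_succ, mul_add, ih (by omega), choose_two_succ]
    rw [show M + 1 + t - M = t + 1 by omega, show M + 1 + t - (M + 1) = t by omega,
      show M + 1 + t + (M + 1) = (M + 1 + t + M) + 1 by omega]
    have h1 := one_sub_mul_qInv_succ (R := R) t
    have h2 := one_sub_mul_qInv_succ (R := R) (M + 1 + t + M)
    rw [← h2]
    have h3 : (-1) ^ M * X ^ ((M + 1).choose 2) * (1 - X ^ (t + 1)) *
        (qInv R (t + 1) * ((1 - X ^ (M + 1 + t + M + 1)) * qInv R (M + 1 + t + M + 1))) =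
        (-1) ^ M * X ^ ((M + 1).choose 2) *
        (qInv R t * ((1 - X ^ (M + 1 + t + M + 1)) * qInv R (M + 1 + t + M + 1))) := by
      rw [← h1]; ring
    rw [h3]
    ring

theorem sum_unit_pair {N : ℕ} (hN : 0 < N) :
    ∑ r ∈ range N, (-1) ^ r * X ^ ((r + 1).choose 2) * (1 + X ^ (r + 1)) *
        (qInv R (N - (r + 1)) * qInv R (N + (r + 1))) = qInv R N * qInv R N := by
  have h := one_sub_mul_sum_unit_pair (R := R) N N le_rfl
  -- At M = N the boundary term carries 1 - X^0 = 0; what remains is divided by 1 - X^N.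
  simp only [Nat.sub_self, pow_zero, sub_self, mul_zero, zero_mul, sub_zero] at h
  have h2 := congrArg (partSeries N (fun _ => (1 : R)) * ·) h
  rwa [← mul_assoc, ← mul_assoc, mul_comm (partSeries N _), one_sub_X_pow_mul_partSeries hN,
    one_mul, one_mul] at h2

/-- A telescoping partial sum for the increment from N to N + 1 of the sum in `sum_pentagonal_pair`.
Writing 1/(q)_{N-r-1} as (1 - X^(N-r))/(q)_{N-r} makes the term r = N vanish, where truncated
subtraction would give 1 instead of 0. -/
theorem sum_pentagonal_pair_sub (N M : ℕ) (hM : M ≤ N + 1) :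
    ∑ r ∈ range M, (-1) ^ r * X ^ (3 * (r + 1).choose 2 + (r + 1)) * (1 + X ^ (r + 1)) *
        (qPoch R (N + 1) * (qInv R (N + 1 - (r + 1)) * qInv R (N + 1 + (r + 1))) -
          qPoch R N * ((1 - X ^ (N + 1 - (r + 1))) * qInv R (N + 1 - (r + 1)) *
            qInv R (N + (r + 1)))) =
      X ^ (N + 1) * qPoch R N * (1 - X ^ (N + 1)) * (qInv R (N + 1) * qInv R (N + 1)) -
        (-1) ^ M * X ^ (3 * (M + 1).choose 2 + (N + 1)) * qPoch R N * (1 - X ^ (N + 1 - M)) *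
          (qInv R (N + 1 - M) * qInv R (N + 1 + M)) := by
  induction M with
  | zero => simp
  | succ M ih =>
    obtain ⟨t, ht⟩ := Nat.exists_eq_add_of_le hM
    obtain rfl : N = M + t := by omega
    rw [sum_range_succ, ih (by omega), choose_two_succ, qPoch_succ]
    rw [show M + t + 1 - M = t + 1 by omega, show M + t + 1 - (M + 1) = t by omega,
      show M + t + 1 + (M + 1) = (M + t + 1 + M) + 1 by omega,
      show M + t + (M + 1) = M + t + 1 + M by omega]
    have h1 := one_sub_mul_qInv_succ (R := R) t
    have h2 := one_sub_mul_qInv_succ (R := R) (M + t + 1 + M)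
    rw [← h2]
    have h3 : (-1) ^ M * X ^ (3 * (M + 1).choose 2 + (M + t + 1)) * qPoch R (M + t) *
          (1 - X ^ (t + 1)) *
        (qInv R (t + 1) * ((1 - X ^ (M + t + 1 + M + 1)) * qInv R (M + t + 1 + M + 1))) =
        (-1) ^ M * X ^ (3 * (M + 1).choose 2 + (M + t + 1)) * qPoch R (M + t) *
        (qInv R t * ((1 - X ^ (M + t + 1 + M + 1)) * qInv R (M + t + 1 + M + 1))) := by
      rw [← h1]; ring
    rw [h3]
    ring

/-- This is the Bailey pair with β_N = 1/(q)_N and pentagonal exponents; the -1 comes from moving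
the index 0 term to the right. -/
theorem sum_pentagonal_pair (N : ℕ) :
    ∑ r ∈ range N, (-1) ^ r * X ^ (3 * (r + 1).choose 2 + (r + 1)) * (1 + X ^ (r + 1)) *
        (qPoch R N * (qInv R (N - (r + 1)) * qInv R (N + (r + 1)))) = qInv R N - 1 := by
  induction N with
  | zero => simp
  | succ N ih =>
    have h := sum_pentagonal_pair_sub (R := R) N (N + 1) le_rfl
    simp only [mul_sub, sum_sub_distrib] at h
    have h2 : ∑ r ∈ range (N + 1), (-1) ^ r * X ^ (3 * (r + 1).choose 2 + (r + 1)) *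
        (1 + X ^ (r + 1)) * (qPoch R N * ((1 - X ^ (N + 1 - (r + 1))) *
          qInv R (N + 1 - (r + 1)) * qInv R (N + (r + 1)))) = qInv R N - 1 := by
      rw [sum_range_succ, ← ih]
      simp only [Nat.sub_self, pow_zero, sub_self, mul_zero, zero_mul, add_zero]
      refine sum_congr rfl fun r hr => ?_
      rw [mem_range] at hr
      obtain ⟨t, rfl⟩ := Nat.exists_eq_add_of_lt hr
      rw [show r + t + 1 + 1 - (r + 1) = t + 1 by omega, one_sub_mul_qInv_succ,
        show r + t + 1 - (r + 1) = t by omega]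
    rw [h2] at h
    have h3 := qPoch_mul_qInv (R := R) N
    have h4 := one_sub_mul_qInv_succ (R := R) N
    simp only [Nat.sub_self, pow_zero, sub_self, zero_mul, sub_zero, mul_one] at h
    rw [sub_eq_iff_eq_add] at h
    rw [h]
    linear_combination (X ^ (N + 1) * qInv R (N + 1)) * h3 +
      (X ^ (N + 1) * qInv R (N + 1) * qPoch R N - 1) * h4

/-- The coefficients `α` of the difference of the two Bailey pairs. -/
noncomputable def baileyAlpha (R : Type*) [CommRing R] (r : ℕ) : R⟦X⟧ :=
  (-1) ^ r * (X ^ ((r + 1).choose 2) - X ^ (3 * (r + 1).choose 2 + (r + 1))) * (1 + X ^ (r + 1))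

/-- After multiplication by (q)_N the two pairs give 1/(q)_N and 1/(q)_N - 1. -/
theorem sum_baileyAlpha {N : ℕ} (hN : 0 < N) :
    ∑ r ∈ range N, baileyAlpha R r *
        (qPoch R N * (qInv R (N - (r + 1)) * qInv R (N + (r + 1)))) = 1 := by
  have h1 := congrArg (qPoch R N * ·) (sum_unit_pair (R := R) hN)
  have h2 := sum_pentagonal_pair (R := R) N
  rw [← mul_assoc, qPoch_mul_qInv, one_mul, mul_sum] at h1
  have : (1 : R⟦X⟧) = qInv R N - (qInv R N - 1) := by ring
  rw [this, ← h2]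
  rw [← h1]
  rw [← sum_sub_distrib]
  refine sum_congr rfl fun r _ => ?_
  rw [baileyAlpha]
  ring

end Bailey

/-! ### The weights in s, and the Bailey expansion of the spt series -/

section Weights

/-- `∑ m, binom(f + m, 2 m) s ^ m`. -/
noncomputable def evenWeight (f : ℕ) : ℤ⟦X⟧ :=
  PowerSeries.mk fun m => ((f + m).choose (2 * m) : ℤ)

/-- `∑ m ≥ 1, binom(f + m - 1, 2 m - 1) s ^ m`. -/
noncomputable def oddWeight (f : ℕ) : ℤ⟦X⟧ :=
  PowerSeries.mk fun m => if m = 0 then 0 else ((f + m - 1).choose (2 * m - 1) : ℤ)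

@[simp] theorem evenWeight_zero : evenWeight 0 = 1 := by
  ext m
  rw [evenWeight, coeff_mk, coeff_one]
  split_ifs with h
  · simp [h]
  · rw [Nat.choose_eq_zero_of_lt (by omega)]; rfl

theorem evenWeight_one : evenWeight 1 = 1 + X := by
  ext m
  rw [evenWeight, coeff_mk, map_add, coeff_one, coeff_X]
  rcases m with _ | _ | m
  · simp
  · simp
  · rw [Nat.choose_eq_zero_of_lt (by omega)]
    simp

@[simp] theorem oddWeight_zero : oddWeight 0 = 0 := by
  ext m
  rw [oddWeight, coeff_mk]
  split_ifs with h
  · simp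
  · rw [Nat.choose_eq_zero_of_lt (by omega)]; simp

theorem oddWeight_one : oddWeight 1 = X := by
  ext m
  rw [oddWeight, coeff_mk, coeff_X]
  rcases m with _ | _ | m
  · simp
  · simp
  · rw [if_neg (by omega), if_neg (by omega), Nat.choose_eq_zero_of_lt (by omega)]
    simp

/-- Pascal's rule applied twice; this is the source of the common recurrence of both weights. -/
theorem choose_second_difference (a b : ℕ) :
    ((a + 2).choose (b + 2) : ℤ) - 2 * ((a + 1).choose (b + 2)) + (a.choose (b + 2)) =
      a.choose b := by
  have h1 := Nat.choose_succ_succ' (a + 1) (b + 1)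
  have h2 := Nat.choose_succ_succ' a (b + 1)
  have h3 := Nat.choose_succ_succ' a b
  push_cast [h1, h2, h3]
  ring

theorem evenWeight_add_two (f : ℕ) :
    evenWeight (f + 2) = (2 + X) * evenWeight (f + 1) - evenWeight f := by
  ext m
  rw [add_mul, map_sub, map_add, show (2 : ℤ⟦X⟧) = C 2 by simp, coeff_C_mul]
  rcases m with _ | m
  · simp [evenWeight]
  · rw [mul_comm X, coeff_succ_mul_X]
    simp only [evenWeight, coeff_mk]
    have := choose_second_difference (f + (m + 1)) (2 * m)
    rw [show f + 2 + (m + 1) = f + (m + 1) + 2 by ring,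
      show f + 1 + (m + 1) = f + (m + 1) + 1 by ring, show 2 * (m + 1) = 2 * m + 2 by ring,
      show f + 1 + m = f + (m + 1) by ring]
    linarith

theorem oddWeight_add_two (f : ℕ) :
    oddWeight (f + 2) = (2 + X) * oddWeight (f + 1) - oddWeight f := by
  ext m
  rw [add_mul, map_sub, map_add, show (2 : ℤ⟦X⟧) = C 2 by simp, coeff_C_mul]
  rcases m with _ | _ | m
  · simp [oddWeight]
  · rw [mul_comm X, coeff_succ_mul_X]
    simp [oddWeight]
    ring
  · rw [mul_comm X, coeff_succ_mul_X]
    simp only [oddWeight, coeff_mk]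
    have := choose_second_difference (f + m + 1) (2 * m + 1)
    rw [if_neg (by omega), if_neg (by omega), if_neg (by omega), if_neg (by omega),
      show f + 2 + (m + 1 + 1) - 1 = f + m + 1 + 2 by omega,
      show f + 1 + (m + 1 + 1) - 1 = f + m + 1 + 1 by omega,
      show f + (m + 1 + 1) - 1 = f + m + 1 by omega,
      show 2 * (m + 1 + 1) - 1 = 2 * m + 1 + 2 by omega,
      show f + 1 + (m + 1) - 1 = f + m + 1 by omega,
      show 2 * (m + 1) - 1 = 2 * m + 1 by omega]
    linarith

/-- The left factor is 1 - (2+s) q^i + q^(2i), the characteristic polynomial of the recurrence, so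
only the two initial terms survive. -/
theorem mul_partSeries_of_recurrence {i : ℕ} (hi : 0 < i) {a : ℕ → ℤ⟦X⟧}
    (ha : ∀ f, a (f + 2) = (2 + X) * a (f + 1) - a f) :
    ((1 - X ^ i) ^ 2 - C X * X ^ i) * partSeries i a =
      C (a 0) + C (a 1 - (2 + X) * a 0) * X ^ i := by
  have h1 : ((1 - X ^ i) ^ 2 - C (X : ℤ⟦X⟧) * X ^ i) * partSeries i a =
      partSeries i a - C (2 + X) * (X ^ i * partSeries i a) +
        X ^ i * (X ^ i * partSeries i a) := by
    rw [map_add, map_ofNat C 2]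
    ring
  have h2 : C (a 0) = partSeries i (fun c => if c = 0 then a 0 else 0) := by
    rw [partSeries_single hi]; simp
  have h3 : C (a 1 - (2 + X) * a 0) * X ^ i =
      partSeries i (fun c => if c = 1 then a 1 - (2 + X) * a 0 else 0) := by
    rw [partSeries_single hi]; simp
  rw [h1, X_pow_mul_partSeries hi, X_pow_mul_partSeries hi, C_mul_partSeries, partSeries_sub,
    partSeries_add, h2, h3, partSeries_add]
  refine congrArg (partSeries i) (funext fun c => ?_)
  rcases c with _ | _ | c
  · simp [shiftSeq]
  · simp [shiftSeq]
  · simp [shiftSeq, ha]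

theorem mul_partSeries_evenWeight {i : ℕ} (hi : 0 < i) :
    ((1 - X ^ i) ^ 2 - C X * X ^ i) * partSeries i evenWeight = 1 - X ^ i := by
  rw [mul_partSeries_of_recurrence hi evenWeight_add_two, evenWeight_zero, evenWeight_one,
    show (1 + X - (2 + X) * 1 : ℤ⟦X⟧) = -1 by ring]
  simp
  ring

theorem mul_partSeries_oddWeight {i : ℕ} (hi : 0 < i) :
    ((1 - X ^ i) ^ 2 - C X * X ^ i) * partSeries i oddWeight = C X * X ^ i := by
  rw [mul_partSeries_of_recurrence hi oddWeight_add_two, oddWeight_zero, oddWeight_one]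
  simp

/-- The generating function, weighted by the higher order spt-weights, of the non-empty partitions
with parts at most `N`. -/
noncomputable def sptSeries (N : ℕ) : ℤ⟦X⟧⟦X⟧ :=
  ∑ n ∈ Icc 1 N, partSeries n oddWeight * ∏ j ∈ Ioc n N, partSeries j evenWeight

theorem sptSeries_succ (N : ℕ) :
    sptSeries (N + 1) =
      sptSeries N * partSeries (N + 1) evenWeight + partSeries (N + 1) oddWeight := by
  rw [sptSeries, Finset.sum_Icc_succ_top (by omega), sptSeries, sum_mul]
  refine congrArg₂ (· + ·) ?_ ?_
  · refine sum_congr rfl fun n hn => ?_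
    rw [Finset.prod_Ioc_succ_top (by have := mem_Icc.mp hn; omega), mul_assoc]
  · simp

/-- Induction on N after multiplying by the denominator β of the new factors. Each summand then
splits into its predecessor at N, times 1 - q^(N+1), and s q^(N+1) times a summand of
`sum_baileyAlpha`. -/
theorem sptSeries_eq_sum (N : ℕ) :
    sptSeries N = ∑ r ∈ range N, baileyAlpha ℤ⟦X⟧ r *
      (qPoch ℤ⟦X⟧ N * (qInv ℤ⟦X⟧ (N - (r + 1)) * qInv ℤ⟦X⟧ (N + (r + 1)))) *
        partSeries (r + 1) oddWeight := by
  induction N with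
  | zero => simp [sptSeries]
  | succ N ih =>
    set β : ℤ⟦X⟧⟦X⟧ := (1 - X ^ (N + 1)) ^ 2 - C X * X ^ (N + 1) with hβ
    have h1 : β * partSeries (N + 1) evenWeight = 1 - X ^ (N + 1) :=
      mul_partSeries_evenWeight N.succ_pos
    have h2 : β * partSeries (N + 1) oddWeight = C X * X ^ (N + 1) :=
      mul_partSeries_oddWeight N.succ_pos
    have hu : IsUnit β := by
      refine IsUnit.of_mul_eq_one
        (partSeries (N + 1) evenWeight * partSeries (N + 1) (fun _ => 1)) ?_
      rw [← mul_assoc, h1, one_sub_X_pow_mul_partSeries N.succ_pos]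
    apply hu.mul_left_cancel
    have h3 : β * sptSeries (N + 1) =
        (1 - X ^ (N + 1)) * sptSeries N + C X * X ^ (N + 1) *
          ∑ r ∈ range (N + 1), baileyAlpha ℤ⟦X⟧ r * (qPoch ℤ⟦X⟧ (N + 1) *
            (qInv ℤ⟦X⟧ (N + 1 - (r + 1)) * qInv ℤ⟦X⟧ (N + 1 + (r + 1)))) := by
      rw [sptSeries_succ, sum_baileyAlpha N.succ_pos]
      linear_combination sptSeries N * h1 + h2
    rw [h3, ih]
    have h4 : ∀ r ∈ range (N + 1), baileyAlpha ℤ⟦X⟧ r * (qPoch ℤ⟦X⟧ (N + 1) *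
          (qInv ℤ⟦X⟧ (N + 1 - (r + 1)) * qInv ℤ⟦X⟧ (N + 1 + (r + 1)))) *
          partSeries (r + 1) oddWeight * β =
        (1 - X ^ (N + 1)) * (baileyAlpha ℤ⟦X⟧ r * (qPoch ℤ⟦X⟧ N *
          ((1 - X ^ (N + 1 - (r + 1))) * qInv ℤ⟦X⟧ (N + 1 - (r + 1)) *
            qInv ℤ⟦X⟧ (N + (r + 1)))) * partSeries (r + 1) oddWeight) +
        C X * X ^ (N + 1) * (baileyAlpha ℤ⟦X⟧ r * (qPoch ℤ⟦X⟧ (N + 1) *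
          (qInv ℤ⟦X⟧ (N + 1 - (r + 1)) * qInv ℤ⟦X⟧ (N + 1 + (r + 1))))) := by
      intro r hr
      rw [mem_range] at hr
      obtain ⟨t, ht⟩ := Nat.exists_eq_add_of_le (show r + 1 ≤ N + 1 by omega)
      obtain rfl : N = r + t := by omega
      rw [show r + t + 1 - (r + 1) = t by omega, qPoch_succ,
        show r + t + 1 + (r + 1) = r + t + (r + 1) + 1 by omega,
        ← one_sub_mul_qInv_succ (r + t + (r + 1))]
      have h5 := mul_partSeries_oddWeight (i := r + 1) r.succ_pos
      rw [hβ]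
      -- With t = N - r this is β = (1 - q^t)(1 - q^(N+r+2)) + q^t ((1 - q^(r+1))^2 - s q^(r+1));
      -- the last bracket cancels against the denominator of the odd series.
      linear_combination (baileyAlpha ℤ⟦X⟧ r * qPoch ℤ⟦X⟧ (r + t) * (1 - X ^ (r + t + 1)) *
        qInv ℤ⟦X⟧ t * qInv ℤ⟦X⟧ (r + t + (r + 1) + 1)) * X ^ t * h5
    rw [mul_comm β, sum_mul, sum_congr rfl h4, sum_add_distrib, ← mul_sum, ← mul_sum]
    refine congrArg₂ (· + ·) (congrArg ((1 - X ^ (N + 1)) * ·) ?_) rfl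
    rw [sum_range_succ]
    simp only [Nat.sub_self, pow_zero, sub_self, mul_zero, zero_mul, add_zero]
    refine sum_congr rfl fun r hr => ?_
    rw [mem_range] at hr
    obtain ⟨t, rfl⟩ := Nat.exists_eq_add_of_lt hr
    rw [show r + t + 1 + 1 - (r + 1) = t + 1 by omega, one_sub_mul_qInv_succ,
      show r + t + 1 - (r + 1) = t by omega]

/-- The limit N → ∞: the Gaussian-type quotient agrees with the partition series modulo q^(N-r), and
the odd series at r + 1 supplies the missing factor q^(r+1). -/
theorem coeff_sptSeries {n N : ℕ} (h : n ≤ N) :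
    coeff n (sptSeries N) = coeff n (partitionSeries ℤ⟦X⟧ *
      ∑ r ∈ range N, baileyAlpha ℤ⟦X⟧ r * partSeries (r + 1) oddWeight) := by
  refine coeff_eq_of_X_pow_dvd_sub (m := N + 1) ?_ (by omega)
  rw [sptSeries_eq_sum, mul_sum, ← sum_sub_distrib]
  refine dvd_sum fun r hr => ?_
  rw [mem_range] at hr
  have h1 : X ^ (r + 1) ∣ partSeries (r + 1) oddWeight := X_pow_dvd_partSeries oddWeight_zero
  have h2 : X ^ (N - (r + 1) + 1) ∣ qPoch ℤ⟦X⟧ N * (qInv ℤ⟦X⟧ (N - (r + 1)) *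
      qInv ℤ⟦X⟧ (N + (r + 1))) - partitionSeries ℤ⟦X⟧ := by
    have ha := X_pow_dvd_qInv_sub (R := ℤ⟦X⟧) (show N - (r + 1) ≤ N by omega)
    have hb : X ^ (N - (r + 1) + 1) ∣ _ :=
      (pow_dvd_pow _ (by omega)).trans
        (X_pow_dvd_qInv_sub (R := ℤ⟦X⟧) (show N ≤ N + (r + 1) by omega))
    have hc : X ^ (N - (r + 1) + 1) ∣ _ := (pow_dvd_pow _ (by omega)).trans
        (X_pow_dvd_partitionSeries_sub (R := ℤ⟦X⟧) N)
    have he := qPoch_mul_qInv (R := ℤ⟦X⟧) N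
    have : qPoch ℤ⟦X⟧ N * (qInv ℤ⟦X⟧ (N - (r + 1)) *
        qInv ℤ⟦X⟧ (N + (r + 1))) - partitionSeries ℤ⟦X⟧ =
        (qPoch ℤ⟦X⟧ N * qInv ℤ⟦X⟧ (N - (r + 1))) *
          (qInv ℤ⟦X⟧ (N + (r + 1)) - qInv ℤ⟦X⟧ N) -
        (qInv ℤ⟦X⟧ N - qInv ℤ⟦X⟧ (N - (r + 1))) -
        (partitionSeries ℤ⟦X⟧ - qInv ℤ⟦X⟧ N) := by
      linear_combination (qInv ℤ⟦X⟧ (N - (r + 1))) * he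
    rw [this]
    exact dvd_sub (dvd_sub (hb.mul_left _) ha) hc
  have h3 := mul_dvd_mul h1 h2
  rw [← pow_add, show r + 1 + (N - (r + 1) + 1) = N + 1 by omega] at h3
  refine h3.trans (Dvd.intro_left (baileyAlpha ℤ⟦X⟧ r) ?_)
  ring

end Weights

/-! ### Dyson's map and the recurrence for rank tails -/

section Rank

theorem sum_map_pred_add_card (s : Multiset ℕ) (hs : ∀ i ∈ s, 0 < i) :
    (s.map (· - 1)).sum + Multiset.card s = s.sum := by
  induction s using Multiset.induction_on with
  | empty => simp
  | cons a s ih =>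
    have h1 := ih fun i hi => hs i (Multiset.mem_cons_of_mem hi)
    have h2 := hs a (Multiset.mem_cons_self a s)
    simp only [Multiset.map_cons, Multiset.sum_cons, Multiset.card_cons]
    omega

/-- Decrementing loses exactly the ones, and the original number of parts tells how many to restore.
This makes Dyson's map invertible. -/
theorem map_succ_filter_map_pred (s : Multiset ℕ) (hs : ∀ i ∈ s, 0 < i) :
    ((s.map (· - 1)).filter (· ≠ 0)).map (· + 1) + Multiset.replicate
      (Multiset.card s - Multiset.card ((s.map (· - 1)).filter (· ≠ 0))) 1 = s := by
  induction s using Multiset.induction_on with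
  | empty => simp
  | cons a s ih =>
    have h1 := ih fun i hi => hs i (Multiset.mem_cons_of_mem hi)
    have h2 := hs a (Multiset.mem_cons_self a s)
    have h3 : Multiset.card ((s.map (· - 1)).filter (· ≠ 0)) ≤ Multiset.card s := by
      simpa using Multiset.card_le_card (Multiset.filter_le (· ≠ 0) (s.map (· - 1)))
    rw [Multiset.map_cons, Multiset.card_cons]
    by_cases ha : a - 1 = 0
    · obtain rfl : a = 1 := by omega
      rw [Multiset.filter_cons_of_neg _ (by simp),
        show Multiset.card s + 1 - Multiset.card ((s.map (· - 1)).filter (· ≠ 0)) =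
          (Multiset.card s - Multiset.card ((s.map (· - 1)).filter (· ≠ 0))) + 1 by omega,
        Multiset.replicate_succ, Multiset.add_cons, h1]
    · rw [Multiset.filter_cons_of_pos (p := (· ≠ 0)) _ ha, Multiset.map_cons, Multiset.card_cons,
        Nat.add_sub_add_right, Multiset.cons_add, h1, Nat.sub_add_cancel h2]

theorem le_largestPart {n : ℕ} (p : n.Partition) {i : ℕ} (hi : i ∈ p.parts) :
    i ≤ largestPart p := Multiset.le_sup hi

theorem largestPart_mem {n : ℕ} (p : n.Partition) (hp : p.parts ≠ 0) :
    largestPart p ∈ p.parts := by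
  have h : p.parts.toFinset.Nonempty := by simpa using hp
  obtain ⟨i, hi, h2⟩ := p.parts.toFinset.exists_max_image id h
  have : largestPart p = i := le_antisymm
    (Multiset.sup_le.mpr fun b hb => h2 b (by simpa using hb))
    (le_largestPart p (by simpa using hi))
  rw [this]
  simpa using hi

theorem sup_filter_ne_zero (s : Multiset ℕ) : (s.filter (· ≠ 0)).sup = s.sup := by
  apply le_antisymm
  · exact Multiset.sup_mono (Multiset.filter_subset _ _)
  · refine Multiset.sup_le.mpr fun b hb => ?_
    by_cases h : b = 0
    · simp [h]
    · exact Multiset.le_sup (Multiset.mem_filter.mpr ⟨hb, h⟩)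

theorem erase_filter_cons (a : ℕ) (s : Multiset ℕ) :
    ((a ::ₘ s).filter (· ≠ 0)).erase a = s.filter (· ≠ 0) := by
  by_cases h : a = 0
  · subst h
    rw [Multiset.filter_cons_of_neg _ (by simp), Multiset.erase_of_notMem (by simp)]
  · rw [Multiset.filter_cons_of_pos (p := (· ≠ 0)) _ h, Multiset.erase_cons_head]

theorem largestPart_erase_cons {n : ℕ} (p : n.Partition) (hp : p.parts ≠ 0) :
    largestPart p ::ₘ p.parts.erase (largestPart p) = p.parts :=
  Multiset.cons_erase (largestPart_mem p hp)

theorem parts_ne_zero_of_pos {n : ℕ} (p : n.Partition) (hn : 0 < n) : p.parts ≠ 0 := by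
  intro h
  have := p.parts_sum
  rw [h] at this
  simp at this
  omega

theorem parts_eq_zero_imp {n : ℕ} (p : n.Partition) (h : p.parts = 0) : n = 0 := by
  have := p.parts_sum
  rw [h] at this
  simpa using this.symm

/-- The number of partitions of `n` with rank at least `r`. -/
def rankGe (r : ℤ) (n : ℕ) : ℕ := (univ.filter fun p : n.Partition => r ≤ rank p).card

/-- The number of partitions of `n` with rank at most `r`. -/
def rankLe (r : ℤ) (n : ℕ) : ℕ := (univ.filter fun p : n.Partition => rank p ≤ r).card

/-- The bound on the rank makes the new part of Dyson's map at least as large as every decremented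
part. The restriction on r serves the empty partition, whose rank is 0. -/
theorem card_add_nonneg {r : ℤ} (hr : 1 ≤ r ∨ r ≤ -3) {n : ℕ} (p : n.Partition)
    (hp : rank p ≤ r + 2) : 0 ≤ (Multiset.card p.parts : ℤ) + r + 1 ∧
      ∀ i ∈ p.parts, (i : ℤ) - 1 ≤ (Multiset.card p.parts : ℤ) + r + 1 := by
  rw [rank] at hp
  have h2 : ∀ i ∈ p.parts, (i : ℤ) - 1 ≤ (Multiset.card p.parts : ℤ) + r + 1 := by
    intro i hi
    have := le_largestPart p hi
    omega
  refine ⟨?_, h2⟩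
  by_cases h : p.parts = 0
  · rw [largestPart, h] at hp
    simp at hp
    omega
  · have h3 := largestPart_mem p h
    have h4 := p.parts_pos h3
    have h5 := h2 _ h3
    omega

theorem card_erase_largestPart_le {r : ℤ} (hr : 1 ≤ r ∨ r ≤ -3) {n : ℕ} (p : n.Partition)
    (hp : r ≤ rank p) :
    (Multiset.card (p.parts.erase (largestPart p)) : ℤ) ≤ (largestPart p : ℤ) - r - 1 := by
  rw [rank] at hp
  by_cases h : p.parts = 0
  · rw [largestPart, h] at hp ⊢
    simp at hp
    simp
    omega
  · have h1 := congrArg Multiset.card (largestPart_erase_cons p h)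
    rw [Multiset.card_cons] at h1
    omega

/-- Dyson's map: remove `1` from every part, and add a part that exceeds the former number of parts
by `r + 1`. -/
def dysonMap {n n' : ℕ} {r : ℤ} (h : (n' : ℤ) = n + r + 1) (p : n.Partition)
    (h0 : 0 ≤ (Multiset.card p.parts : ℤ) + r + 1) : n'.Partition :=
  Nat.Partition.ofSums n'
    (((Multiset.card p.parts : ℤ) + r + 1).toNat ::ₘ p.parts.map (· - 1)) (by
      have h1 := sum_map_pred_add_card p.parts (fun _ hi => p.parts_pos hi)
      rw [p.parts_sum] at h1
      rw [Multiset.sum_cons]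
      omega)

/-- The inverse of Dyson's map. -/
def dysonInv {n n' : ℕ} {r : ℤ} (h : (n' : ℤ) = n + r + 1) (p : n'.Partition)
    (h0 : (Multiset.card (p.parts.erase (largestPart p)) : ℤ) ≤ (largestPart p : ℤ) - r - 1) :
    n.Partition where
  parts := (p.parts.erase (largestPart p)).map (· + 1) + Multiset.replicate
    ((largestPart p : ℤ) - r - 1 - Multiset.card (p.parts.erase (largestPart p))).toNat 1
  parts_pos := by
    intro i hi
    rw [Multiset.mem_add, Multiset.mem_map] at hi
    rcases hi with ⟨a, _, rfl⟩ | hi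
    · exact a.succ_pos
    · rw [Multiset.eq_of_mem_replicate hi]; exact one_pos
  parts_sum := by
    have h1 : ((p.parts.erase (largestPart p)).sum : ℤ) + largestPart p = n' := by
      by_cases hp : p.parts = 0
      · have := parts_eq_zero_imp p hp
        subst this
        simp [largestPart]
      · have h2 := congrArg Multiset.sum (largestPart_erase_cons p hp)
        rw [Multiset.sum_cons, p.parts_sum] at h2
        omega
    rw [Multiset.sum_add, Multiset.sum_map_add, Multiset.sum_replicate]
    simp only [Multiset.map_id', Multiset.map_const', Multiset.sum_replicate, smul_eq_mul, mul_one]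
    omega

theorem largestPart_dysonMap {n n' : ℕ} {r : ℤ} (h : (n' : ℤ) = n + r + 1) (p : n.Partition)
    (h0 : 0 ≤ (Multiset.card p.parts : ℤ) + r + 1)
    (h1 : ∀ i ∈ p.parts, (i : ℤ) - 1 ≤ (Multiset.card p.parts : ℤ) + r + 1) :
    largestPart (dysonMap h p h0) = ((Multiset.card p.parts : ℤ) + r + 1).toNat := by
  rw [largestPart, dysonMap, Nat.Partition.ofSums_parts, sup_filter_ne_zero, Multiset.sup_cons,
    sup_eq_left, Multiset.sup_le]
  intro b hb
  obtain ⟨i, hi, rfl⟩ := Multiset.mem_map.mp hb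
  have := h1 i hi
  omega

theorem dysonMap_parts_erase {n n' : ℕ} {r : ℤ} (h : (n' : ℤ) = n + r + 1) (p : n.Partition)
    (h0 : 0 ≤ (Multiset.card p.parts : ℤ) + r + 1) :
    (dysonMap h p h0).parts.erase ((Multiset.card p.parts : ℤ) + r + 1).toNat =
      (p.parts.map (· - 1)).filter (· ≠ 0) := by
  rw [dysonMap, Nat.Partition.ofSums_parts, erase_filter_cons]

theorem card_parts_dysonMap_le {n n' : ℕ} {r : ℤ} (h : (n' : ℤ) = n + r + 1) (p : n.Partition)
    (h0 : 0 ≤ (Multiset.card p.parts : ℤ) + r + 1) :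
    Multiset.card (dysonMap h p h0).parts ≤ Multiset.card p.parts + 1 := by
  rw [dysonMap, Nat.Partition.ofSums_parts]
  refine (Multiset.card_le_card (Multiset.filter_le _ _)).trans ?_
  simp

theorem card_parts_dysonInv {n n' : ℕ} {r : ℤ} (h : (n' : ℤ) = n + r + 1) (p : n'.Partition)
    (h0 : (Multiset.card (p.parts.erase (largestPart p)) : ℤ) ≤ (largestPart p : ℤ) - r - 1) :
    (Multiset.card (dysonInv h p h0).parts : ℤ) = (largestPart p : ℤ) - r - 1 := by
  rw [dysonInv]
  simp only [Multiset.card_add, Multiset.card_map, Multiset.card_replicate]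
  omega

theorem largestPart_dysonInv_le {n n' : ℕ} {r : ℤ} (h : (n' : ℤ) = n + r + 1) (p : n'.Partition)
    (h0 : (Multiset.card (p.parts.erase (largestPart p)) : ℤ) ≤ (largestPart p : ℤ) - r - 1) :
    largestPart (dysonInv h p h0) ≤ largestPart p + 1 := by
  rw [largestPart, Multiset.sup_le]
  intro b hb
  rw [dysonInv, Multiset.mem_add, Multiset.mem_map] at hb
  rcases hb with ⟨a, ha, rfl⟩ | hb
  · have := le_largestPart p (Multiset.mem_of_mem_erase ha)
    omega
  · rw [Multiset.eq_of_mem_replicate hb]; omega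

theorem filter_dysonInv_parts {n n' : ℕ} {r : ℤ} (h : (n' : ℤ) = n + r + 1) (p : n'.Partition)
    (h0 : (Multiset.card (p.parts.erase (largestPart p)) : ℤ) ≤ (largestPart p : ℤ) - r - 1) :
    (largestPart p ::ₘ (dysonInv h p h0).parts.map (· - 1)).filter (· ≠ 0) = p.parts := by
  rw [dysonInv]
  simp only [Multiset.map_add, Multiset.map_map, Function.comp_def, Nat.add_sub_cancel,
    Multiset.map_id', Multiset.map_replicate, Nat.sub_self]
  rw [← Multiset.cons_add, Multiset.filter_add]
  have h1 : ∀ c, (Multiset.replicate c 0).filter (· ≠ 0) = 0 := by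
    intro c
    rw [Multiset.filter_eq_nil]
    intro a ha
    simp [Multiset.eq_of_mem_replicate ha]
  rw [h1, add_zero]
  by_cases hp : p.parts = 0
  · simp [largestPart, hp]
  · rw [largestPart_erase_cons p hp, Multiset.filter_eq_self]
    exact fun a ha => (p.parts_pos ha).ne'

/-- Dyson's relation between the partitions with rank at least `r` and those with rank at most
`r + 2`. -/
theorem rankGe_eq_rankLe {n n' : ℕ} {r : ℤ} (hr : 1 ≤ r ∨ r ≤ -3) (h : (n' : ℤ) = n + r + 1) :
    rankGe r n' = rankLe (r + 2) n := by
  symm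
  refine Finset.card_bij'
    (fun p hp => dysonMap h p (card_add_nonneg hr p (mem_filter.mp hp).2).1)
    (fun p hp => dysonInv h p (card_erase_largestPart_le hr p (mem_filter.mp hp).2)) ?_ ?_ ?_ ?_
  · intro p hp
    obtain ⟨h0, h1⟩ := card_add_nonneg hr p (mem_filter.mp hp).2
    have h2 := largestPart_dysonMap h p h0 h1
    have h3 := card_parts_dysonMap_le h p h0
    rw [mem_filter, rank, h2]
    exact ⟨mem_univ _, by omega⟩
  · intro p hp
    have h0 := card_erase_largestPart_le hr p (mem_filter.mp hp).2
    have h2 := largestPart_dysonInv_le h p h0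
    have h3 := card_parts_dysonInv h p h0
    refine mem_filter.mpr ⟨mem_univ _, ?_⟩
    change (largestPart (dysonInv h p h0) : ℤ) - Multiset.card (dysonInv h p h0).parts ≤ r + 2
    omega
  -- The inserted part is the largest, so erasing it leaves the nonzero decremented parts.
  · intro p hp
    obtain ⟨h0, h1⟩ := card_add_nonneg hr p (mem_filter.mp hp).2
    have h2 := largestPart_dysonMap h p h0 h1
    have h3 := dysonMap_parts_erase h p h0
    have h4 := map_succ_filter_map_pred p.parts (fun _ hi => p.parts_pos hi)
    apply Nat.Partition.ext
    simp only [dysonInv]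
    rw [h2, h3]
    convert! h4 using 3
    omega
  · intro p hp
    have h0 := card_erase_largestPart_le hr p (mem_filter.mp hp).2
    have h3 := card_parts_dysonInv h p h0
    apply Nat.Partition.ext
    rw [dysonMap, Nat.Partition.ofSums_parts]
    refine Eq.trans ?_ (filter_dysonInv_parts h p h0)
    congr 2
    omega

theorem rankGe_add_rankLe (r : ℤ) (n : ℕ) :
    rankGe r n + rankLe (r - 1) n = Fintype.card n.Partition := by
  rw [rankGe, rankLe, ← Finset.card_univ, ← Finset.card_filter_add_card_filter_not
    (s := (univ : Finset n.Partition)) (fun p => r ≤ rank p)]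
  congr 2
  ext p
  simp only [mem_filter, mem_univ, true_and]
  omega

theorem abs_rank_lt {n : ℕ} (p : n.Partition) (hn : 0 < n) : rank p < n ∧ -(n : ℤ) < rank p := by
  have h0 := largestPart_mem p (parts_ne_zero_of_pos p hn)
  have h1 := p.parts_pos h0
  have h2 : largestPart p ≤ n := Nat.Partition.le_of_mem_parts h0
  have h3 : 0 < Multiset.card p.parts := Multiset.card_pos.mpr (parts_ne_zero_of_pos p hn)
  have h4 := sum_map_pred_add_card p.parts (fun _ hi => p.parts_pos hi)
  rw [p.parts_sum] at h4
  rw [rank]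
  omega

theorem rank_eq_zero_of_zero (p : (0 : ℕ).Partition) : rank p = 0 := by
  simp [rank, largestPart]

theorem abs_rank_le {n : ℕ} (p : n.Partition) : rank p ≤ n ∧ -(n : ℤ) ≤ rank p := by
  rcases Nat.eq_zero_or_pos n with rfl | hn
  · simp [rank_eq_zero_of_zero]
  · have := abs_rank_lt p hn
    omega

/-- The generating function of the partitions with rank at least `r`. -/
noncomputable def rankGeSeries (r : ℕ) : ℤ⟦X⟧ := PowerSeries.mk fun n => (rankGe r n : ℤ)

/-- The generating function of the partitions with rank at most `-r`. -/
noncomputable def rankLeSeries (r : ℕ) : ℤ⟦X⟧ := PowerSeries.mk fun n => (rankLe (-r) n : ℤ)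

/-- Dyson's relation followed by complementation: rank at most r + 2 is the complement of rank at
least r + 3. Degrees at most r vanish, since the rank is less than the size. -/
theorem rankGeSeries_eq {r : ℕ} (hr : 0 < r) :
    rankGeSeries r = X ^ (r + 1) * (partitionSeries ℤ - rankGeSeries (r + 3)) := by
  ext n
  rw [coeff_X_pow_mul']
  split_ifs with h
  · obtain ⟨m, rfl⟩ := Nat.exists_eq_add_of_le' h
    have h1 := rankGe_eq_rankLe (n := m) (n' := m + (r + 1)) (r := r) (by omega)
      (by push_cast; ring)
    have h2 := rankGe_add_rankLe (r + 3) m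
    rw [show (r : ℤ) + 3 - 1 = r + 2 by ring, ← h1] at h2
    simp only [rankGeSeries, partitionSeries, coeff_mk, map_sub, Nat.add_sub_cancel, ← h2]
    push_cast
    ring
  · simp only [rankGeSeries, coeff_mk, Nat.cast_eq_zero, rankGe, card_eq_zero,
      filter_eq_empty_iff, mem_univ, true_imp_iff, not_le]
    intro p
    rcases Nat.eq_zero_or_pos n with rfl | hn
    · rw [rank_eq_zero_of_zero]; exact_mod_cast hr
    · have := abs_rank_lt p hn
      omega

theorem rankLeSeries_eq {r : ℕ} (hr : 0 < r) :
    rankLeSeries r = X ^ (r + 1) * (partitionSeries ℤ - rankLeSeries (r + 3)) := by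
  ext n
  rw [coeff_X_pow_mul']
  split_ifs with h
  · obtain ⟨m, rfl⟩ := Nat.exists_eq_add_of_le' h
    -- Dyson's relation read backwards, at -r - 2.
    have h1 := rankGe_eq_rankLe (n := m + (r + 1)) (n' := m) (r := -r - 2) (by omega)
      (by push_cast; ring)
    have h2 := rankGe_add_rankLe (-r - 2) m
    rw [show -(r : ℤ) - 2 - 1 = -r - 3 by ring, h1, show -(r : ℤ) - 2 + 2 = -r by ring] at h2
    simp only [rankLeSeries, partitionSeries, coeff_mk, map_sub, Nat.add_sub_cancel, ← h2]
    push_cast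
    rw [show -(r + 3 : ℤ) = -r - 3 by ring]
    ring
  · simp only [rankLeSeries, coeff_mk, Nat.cast_eq_zero, rankLe, card_eq_zero,
      filter_eq_empty_iff, mem_univ, true_imp_iff, not_le]
    intro p
    rcases Nat.eq_zero_or_pos n with rfl | hn
    · rw [rank_eq_zero_of_zero]; omega
    · have := abs_rank_lt p hn
      omega

end Rank

/-! ### Infinite sums of power series converging in the q-adic sense -/

section LSum

variable {R : Type*} [CommRing R]

/-- The sum `∑ w, F w` of a sequence of power series such that `X ^ w` divides `F w`. -/
noncomputable def lsum (F : ℕ → R⟦X⟧) : R⟦X⟧ :=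
  PowerSeries.mk fun n => coeff n (∑ w ∈ range (n + 1), F w)

theorem coeff_sum_range_eq {F : ℕ → R⟦X⟧} (hF : ∀ w, X ^ w ∣ F w) {n W : ℕ} (h : n < W) :
    coeff n (∑ w ∈ range W, F w) = coeff n (∑ w ∈ range (n + 1), F w) := by
  rw [map_sum, map_sum]
  symm
  refine sum_subset (range_subset_range.mpr h) fun w _ hw => ?_
  exact X_pow_dvd_iff.mp (hF w) n (by simpa using hw)

theorem X_pow_dvd_lsum_sub {F : ℕ → R⟦X⟧} (hF : ∀ w, X ^ w ∣ F w) (W : ℕ) :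
    X ^ W ∣ lsum F - ∑ w ∈ range W, F w := by
  rw [X_pow_dvd_iff]
  intro n hn
  rw [map_sub, coeff_sum_range_eq hF hn, lsum, coeff_mk, sub_self]

theorem eq_of_forall_X_pow_dvd_sub {f g : R⟦X⟧} (h : ∀ W, X ^ W ∣ f - g) : f = g := by
  ext n
  exact coeff_eq_of_X_pow_dvd_sub (h (n + 1)) n.lt_succ_self

theorem lsum_sub (F G : ℕ → R⟦X⟧) : lsum F - lsum G = lsum fun w => F w - G w := by
  ext n
  simp [lsum]

theorem mul_lsum (c : R⟦X⟧) {F : ℕ → R⟦X⟧} (hF : ∀ w, X ^ w ∣ F w) :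
    c * lsum F = lsum fun w => c * F w := by
  refine eq_of_forall_X_pow_dvd_sub fun W => ?_
  have h1 := X_pow_dvd_lsum_sub hF W
  have h2 := X_pow_dvd_lsum_sub (F := fun w => c * F w) (fun w => (hF w).mul_left c) W
  have : c * lsum F - lsum (fun w => c * F w) = c * (lsum F - ∑ w ∈ range W, F w) -
      (lsum (fun w => c * F w) - ∑ w ∈ range W, c * F w) := by
    rw [← mul_sum]; ring
  rw [this]
  exact dvd_sub (h1.mul_left c) h2

theorem lsum_eq_add {F : ℕ → R⟦X⟧} (hF : ∀ w, X ^ w ∣ F w) :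
    lsum F = F 0 + lsum fun w => F (w + 1) := by
  refine eq_of_forall_X_pow_dvd_sub fun W => ?_
  have h1 := X_pow_dvd_lsum_sub hF (W + 1)
  have h2 := X_pow_dvd_lsum_sub (F := fun w => F (w + 1))
    (fun w => (pow_dvd_pow _ w.le_succ).trans (hF (w + 1))) W
  rw [sum_range_succ'] at h1
  have : lsum F - (F 0 + lsum fun w => F (w + 1)) =
      (lsum F - (∑ w ∈ range W, F (w + 1) + F 0)) -
        (lsum (fun w => F (w + 1)) - ∑ w ∈ range W, F (w + 1)) := by
    ring
  rw [this]
  exact dvd_sub ((pow_dvd_pow _ W.le_succ).trans h1) h2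

theorem X_pow_dvd_lsum {F : ℕ → R⟦X⟧} {M : ℕ} (h : ∀ w, X ^ M ∣ F w) : X ^ M ∣ lsum F := by
  rw [X_pow_dvd_iff]
  intro n hn
  rw [lsum, coeff_mk]
  exact X_pow_dvd_iff.mp (dvd_sum fun w _ => h w) n hn

end LSum

/-! ### Durfee rectangle series and the recurrence for crank tails -/

section Durfee

/-- The term `q ^ (w (w + m) + a w) / ((q)_w (q)_{w + m})` of the series `durfee m a`. -/
noncomputable def durfeeTerm (m a w : ℕ) : ℤ⟦X⟧ :=
  X ^ (w * (w + m) + a * w) * (qInv ℤ w * qInv ℤ (w + m))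

theorem X_pow_dvd_durfeeTerm (m a w : ℕ) : X ^ w ∣ durfeeTerm m a w := by
  refine Dvd.dvd.mul_right (pow_dvd_pow _ ?_) _
  nlinarith [Nat.zero_le (w * m), Nat.zero_le (a * w), Nat.le_mul_self w]

/-- The series `∑ w, q ^ (w (w + m) + a w) / ((q)_w (q)_{w + m})`. -/
noncomputable def durfee (m a : ℕ) : ℤ⟦X⟧ := lsum (durfeeTerm m a)

/-- Termwise, 1 - q^w cancels the last factor of (q)_w; the term w = 0 vanishes and the index shifts
by one. -/
theorem durfee_sub (m a : ℕ) :
    durfee m a - durfee m (a + 1) = X ^ (m + 1 + a) * durfee (m + 1) (a + 1) := by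
  rw [durfee, durfee, lsum_sub, lsum_eq_add
    (fun w => dvd_sub (X_pow_dvd_durfeeTerm m a w) (X_pow_dvd_durfeeTerm m (a + 1) w)), durfee,
    mul_lsum _ (X_pow_dvd_durfeeTerm _ _)]
  have h0 : durfeeTerm m a 0 - durfeeTerm m (a + 1) 0 = 0 := by simp [durfeeTerm]
  rw [h0, zero_add]
  refine congrArg lsum (funext fun w => ?_)
  have h1 := one_sub_mul_qInv_succ (R := ℤ) w
  rw [durfeeTerm, durfeeTerm, durfeeTerm, ← h1]
  rw [show w + (m + 1) = w + 1 + m by ring]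
  ring

/-- Here 1 - q^(w+m+1) cancels the last factor of (q)_{w+m+1}. -/
theorem durfee_succ_sub (m a : ℕ) :
    durfee (m + 1) a - X ^ (m + 1) * durfee (m + 1) (a + 1) = durfee m (a + 1) := by
  rw [durfee, durfee, mul_lsum _ (X_pow_dvd_durfeeTerm _ _), lsum_sub, durfee]
  refine congrArg lsum (funext fun w => ?_)
  have h1 := one_sub_mul_qInv_succ (R := ℤ) (w + m)
  rw [durfeeTerm, durfeeTerm, durfeeTerm, ← h1]
  rw [show w + (m + 1) = w + m + 1 by ring]
  ring

theorem durfee_zero_right_succ (m : ℕ) : durfee (m + 1) 0 = durfee m 0 := by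
  linear_combination durfee_succ_sub m 0 - durfee_sub m 0

/-- Combinatorially, the Durfee rectangle decomposition. Algebraically, the series does not depend
on m, and for large m only the term w = 0 is left in low degrees. -/
theorem durfee_zero_right (m : ℕ) : durfee m 0 = partitionSeries ℤ := by
  refine eq_of_forall_X_pow_dvd_sub fun W => ?_
  have h1 : ∀ j, durfee (m + j) 0 = durfee m 0 := by
    intro j
    induction j with
    | zero => rfl
    | succ j ih => rw [← add_assoc, durfee_zero_right_succ, ih]
  have h2 : X ^ (m + W + 1) ∣ durfee (m + W) 0 - qInv ℤ (m + W) := by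
    rw [durfee, lsum_eq_add (X_pow_dvd_durfeeTerm _ _),
      show durfeeTerm (m + W) 0 0 = qInv ℤ (m + W) by simp [durfeeTerm], add_sub_cancel_left]
    refine X_pow_dvd_lsum fun w => Dvd.dvd.mul_right (pow_dvd_pow _ ?_) _
    nlinarith [Nat.zero_le (w * (w + m + W))]
  have h3 := X_pow_dvd_partitionSeries_sub (R := ℤ) (m + W)
  rw [← h1 W, show durfee (m + W) 0 - partitionSeries ℤ = (durfee (m + W) 0 - qInv ℤ (m + W)) -
    (partitionSeries ℤ - qInv ℤ (m + W)) by ring]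
  exact (pow_dvd_pow _ (by omega)).trans (dvd_sub h2 h3)

/-- The generating function of the partitions with crank at least `r`, for `r ≥ 1`. -/
noncomputable def crankGeSeries (r : ℕ) : ℤ⟦X⟧ := X ^ r * durfee r 1

theorem crankGeSeries_eq (r : ℕ) :
    crankGeSeries r = X ^ r * (partitionSeries ℤ - crankGeSeries (r + 1)) := by
  rw [crankGeSeries, crankGeSeries, ← durfee_zero_right r]
  linear_combination -X ^ r * durfee_sub r 0

/-- The right side is the form in which the partitions of crank exactly m, or exactly -m, get
counted. -/
theorem crankGeSeries_sub (m : ℕ) :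
    crankGeSeries m - crankGeSeries (m + 1) = (1 - X) * X ^ m * durfee m 2 := by
  rw [crankGeSeries, crankGeSeries]
  linear_combination X ^ m * durfee_sub m 1 - X ^ (m + 1) * durfee_succ_sub m 1

end Durfee

/-! ### Euler's expansion of ∏_{i>w} 1/(1 - z q^i) -/

section LargeParts

/-- The term `z ^ v q ^ (v (w + 1)) / (q)_v`, where `z` is the inner and `q` the outer variable. -/
noncomputable def largePartTerm (w v : ℕ) : ℤ⟦X⟧⟦X⟧ :=
  C (X ^ v) * (X ^ (v * (w + 1)) * qInv ℤ⟦X⟧ v)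

theorem X_pow_dvd_largePartTerm (w v : ℕ) : X ^ v ∣ largePartTerm w v := by
  refine Dvd.dvd.mul_left (Dvd.dvd.mul_right (pow_dvd_pow _ ?_) _) _
  nlinarith [Nat.zero_le (v * w)]

/-- The q-difference equation behind Euler's expansion: 1 - q^v cancels the last factor of (q)_v,
and shifting v produces z q^(w+1). -/
theorem one_sub_mul_lsum_largePartTerm (w : ℕ) :
    (1 - C X * X ^ (w + 1)) * lsum (largePartTerm w) = lsum (largePartTerm (w + 1)) := by
  have h : lsum (largePartTerm w) - lsum (largePartTerm (w + 1)) =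
      (C X * X ^ (w + 1)) * lsum (largePartTerm w) := by
    rw [lsum_sub, lsum_eq_add
      (fun v => dvd_sub (X_pow_dvd_largePartTerm w v) (X_pow_dvd_largePartTerm (w + 1) v)),
      mul_lsum _ (X_pow_dvd_largePartTerm _)]
    have h0 : largePartTerm w 0 - largePartTerm (w + 1) 0 = 0 := by simp [largePartTerm]
    rw [h0, zero_add]
    refine congrArg lsum (funext fun v => ?_)
    have h1 := one_sub_mul_qInv_succ (R := ℤ⟦X⟧) v
    rw [largePartTerm, largePartTerm, largePartTerm, ← h1, map_pow, map_pow]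
    ring
  linear_combination h

theorem lsum_largePartTerm_eq {w N : ℕ} (h : w ≤ N) :
    lsum (largePartTerm w) = (∏ i ∈ Ioc w N, partSeries i (fun c => (X : ℤ⟦X⟧) ^ c)) *
      lsum (largePartTerm N) := by
  induction N, h using Nat.le_induction with
  | base => simp
  | succ N hN ih =>
    rw [Finset.prod_Ioc_succ_top (by omega), ih, ← one_sub_mul_lsum_largePartTerm]
    have h1 : (1 - C X * X ^ (N + 1)) * partSeries (N + 1) (fun c => (X : ℤ⟦X⟧) ^ c) = 1 :=
      partSeries_pow_mul N.succ_pos (X : ℤ⟦X⟧)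
    linear_combination -(∏ i ∈ Ioc w N, partSeries i (fun c => (X : ℤ⟦X⟧) ^ c)) *
      lsum (largePartTerm N) * h1

theorem X_pow_dvd_lsum_largePartTerm_sub_one (N : ℕ) :
    X ^ (N + 1) ∣ lsum (largePartTerm N) - 1 := by
  rw [lsum_eq_add (X_pow_dvd_largePartTerm _),
    show largePartTerm N 0 = 1 by simp [largePartTerm], add_sub_cancel_left]
  refine X_pow_dvd_lsum fun v => Dvd.dvd.mul_left (Dvd.dvd.mul_right (pow_dvd_pow _ ?_) _) _
  nlinarith [Nat.zero_le (v * (N + 1))]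

theorem map_partSeries {R S : Type*} [CommRing R] [CommRing S] (f : R →+* S) (i : ℕ)
    (a : ℕ → R) : PowerSeries.map f (partSeries i a) = partSeries i (fun c => f (a c)) := by
  ext m
  rw [coeff_map, coeff_partSeries, coeff_partSeries]
  split_ifs <;> simp

theorem map_qInv {R S : Type*} [CommRing R] [CommRing S] (f : R →+* S) (n : ℕ) :
    PowerSeries.map f (qInv R n) = qInv S n := by
  simp [qInv, map_prod, map_partSeries]

/-- `G` is free of z, so the coefficient of z^v selects the v-th term of the expansion. -/
theorem coeff_coeff_mul_lsum_largePartTerm (G : ℤ⟦X⟧) (w v n : ℕ) :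
    coeff v (coeff n (PowerSeries.map C G * lsum (largePartTerm w))) =
      coeff n (G * (X ^ (v * (w + 1)) * qInv ℤ v)) := by
  rw [mul_lsum _ (X_pow_dvd_largePartTerm _), lsum, coeff_mk, map_sum, map_sum]
  have h1 : ∀ u, coeff v (coeff n (PowerSeries.map C G * largePartTerm w u)) =
      if v = u then coeff n (G * (X ^ (u * (w + 1)) * qInv ℤ u)) else 0 := by
    intro u
    have : PowerSeries.map C G * largePartTerm w u = C (X ^ u) *
        PowerSeries.map C (G * (X ^ (u * (w + 1)) * qInv ℤ u)) := by
      rw [largePartTerm, map_mul, map_mul, map_pow (PowerSeries.map C), map_X, map_qInv]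
      ring
    rw [this, coeff_C_mul, coeff_map, mul_comm, coeff_C_mul, coeff_X_pow]
    simp
  rw [sum_congr rfl fun u _ => h1 u, sum_ite_eq]
  split_ifs with h
  · rfl
  · symm
    refine X_pow_dvd_iff.mp (Dvd.dvd.mul_left (Dvd.dvd.mul_right (pow_dvd_pow _ (?_ : v ≤ _)) _) _)
      n (by simpa using h)
    nlinarith [Nat.zero_le (v * w)]

end LargeParts

/-! ### Counting partitions by crank -/

section CrankCount

theorem prod_Icc_one_split {M : Type*} [CommMonoid M] (f : ℕ → M) {w N : ℕ} (hw : 1 ≤ w)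
    (h : w ≤ N) :
    ∏ i ∈ Icc 1 N, f i = f 1 * (∏ i ∈ Ioc 1 w, f i) * ∏ i ∈ Ioc w N, f i := by
  rw [mul_assoc, Finset.prod_Ioc_consecutive f hw h, ← Finset.mul_prod_Ioc_eq_prod_Icc (by omega)]

theorem prod_Ioc_one_partSeries (R : Type*) [CommRing R] {w : ℕ} (hw : 1 ≤ w) :
    ∏ i ∈ Ioc 1 w, partSeries i (fun _ => (1 : R)) = (1 - X) * qInv R w := by
  rw [qInv_eq_prod_Icc, ← Finset.mul_prod_Ioc_eq_prod_Icc hw, ← mul_assoc]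
  have := one_sub_X_pow_mul_partSeries (R := R) one_pos
  rw [pow_one] at this
  rw [this, one_mul]

theorem card_filter_lt_eq_sum {n N : ℕ} (p : n.Partition) (hN : n ≤ N) (w : ℕ) :
    Multiset.card (p.parts.filter (fun a => w < a)) = ∑ i ∈ Ioc w N, p.parts.count i := by
  rw [← Multiset.sum_count_eq_card (s := Ioc w N)]
  · refine sum_congr rfl fun i hi => ?_
    rw [Multiset.count_filter_of_pos (mem_Ioc.mp hi).1]
  · intro a ha
    obtain ⟨h1, h2⟩ := Multiset.mem_filter.mp ha
    exact mem_Ioc.mpr ⟨h2, (Nat.Partition.le_of_mem_parts h1).trans hN⟩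

/-- The generating function of the partitions with `w ≥ 1` ones and `v` parts larger than `w`. -/
theorem card_count_one_eq_and_card_filter_eq {w : ℕ} (hw : 1 ≤ w) (v n : ℕ) :
    ((univ.filter fun p : n.Partition => p.parts.count 1 = w ∧
      Multiset.card (p.parts.filter (fun a => w < a)) = v).card : ℤ) =
    coeff n ((1 - X) * X ^ (w + v * (w + 1)) * (qInv ℤ w * qInv ℤ v)) := by
  set N := max n w with hN
  have hnN : n ≤ N := le_max_left _ _
  have hwN : w ≤ N := le_max_right _ _
  -- Exactly w ones, parts from 2 to w free, and z marking each part larger than w.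
  let φ : ℕ → ℕ → ℤ⟦X⟧ := fun i c =>
    if i = 1 then (if c = w then 1 else 0) else if i ≤ w then 1 else X ^ c
  have h1 := sum_prod_count_eq_coeff φ hnN
  have h2 : ∀ p : n.Partition, ∏ i ∈ Icc 1 N, φ i (p.parts.count i) =
      if p.parts.count 1 = w then
        X ^ (Multiset.card (p.parts.filter (fun a => w < a))) else 0 := by
    intro p
    rw [prod_Icc_one_split _ hw hwN]
    have ha : ∏ i ∈ Ioc 1 w, φ i (p.parts.count i) = 1 := by
      refine prod_eq_one fun i hi => ?_
      have := mem_Ioc.mp hi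
      simp only [φ]
      rw [if_neg (by omega), if_pos (by omega)]
    have hb : ∏ i ∈ Ioc w N, φ i (p.parts.count i) =
        X ^ (Multiset.card (p.parts.filter (fun a => w < a))) := by
      rw [card_filter_lt_eq_sum p hnN w, ← prod_pow_eq_pow_sum]
      refine prod_congr rfl fun i hi => ?_
      have := mem_Ioc.mp hi
      simp only [φ]
      rw [if_neg (by omega), if_neg (by omega)]
    rw [ha, hb]
    simp [φ]
  have h3 : ∏ i ∈ Icc 1 N, partSeries i (φ i) =
      PowerSeries.map C ((1 - X) * X ^ w * qInv ℤ w) *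
        ∏ i ∈ Ioc w N, partSeries i (fun c => (X : ℤ⟦X⟧) ^ c) := by
    rw [prod_Icc_one_split _ hw hwN]
    have ha : partSeries 1 (φ 1) = X ^ w := by
      have : φ 1 = fun c => if c = w then 1 else 0 := by funext c; simp [φ]
      rw [this, partSeries_single one_pos]
      simp
    have hb : ∏ i ∈ Ioc 1 w, partSeries i (φ i) = (1 - X) * qInv ℤ⟦X⟧ w := by
      rw [← prod_Ioc_one_partSeries _ hw]
      refine prod_congr rfl fun i hi => ?_
      have := mem_Ioc.mp hi
      refine congrArg (partSeries i) (funext fun c => ?_)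
      simp only [φ]
      rw [if_neg (by omega), if_pos (by omega)]
    have hc : ∏ i ∈ Ioc w N, partSeries i (φ i) =
        ∏ i ∈ Ioc w N, partSeries i (fun c => (X : ℤ⟦X⟧) ^ c) := by
      refine prod_congr rfl fun i hi => ?_
      have := mem_Ioc.mp hi
      refine congrArg (partSeries i) (funext fun c => ?_)
      simp only [φ]
      rw [if_neg (by omega), if_neg (by omega)]
    rw [ha, hb, hc, map_mul, map_mul, map_sub, map_one, map_pow, map_X, map_qInv]
    ring
  have h4 : coeff n (∏ i ∈ Icc 1 N, partSeries i (φ i)) =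
      coeff n (PowerSeries.map C ((1 - X) * X ^ w * qInv ℤ w) * lsum (largePartTerm w)) := by
    refine coeff_eq_of_X_pow_dvd_sub (m := N + 1) ?_ (by omega)
    rw [h3, lsum_largePartTerm_eq hwN, ← mul_assoc, ← mul_one_sub]
    refine Dvd.dvd.mul_left ?_ _
    rw [← neg_sub, dvd_neg]
    exact X_pow_dvd_lsum_largePartTerm_sub_one N
  rw [h4] at h1
  have h5 := congrArg (coeff v) h1
  rw [coeff_coeff_mul_lsum_largePartTerm, map_sum] at h5
  rw [show (1 - X) * X ^ (w + v * (w + 1)) * (qInv ℤ w * qInv ℤ v) =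
    (1 - X) * X ^ w * qInv ℤ w * (X ^ (v * (w + 1)) * qInv ℤ v) by ring, ← h5,
    Finset.card_filter]
  push_cast
  refine sum_congr rfl fun p _ => ?_
  rw [h2 p]
  by_cases ha : p.parts.count 1 = w
  · rw [if_pos ha, coeff_X_pow]
    simp [ha, eq_comm]
  · rw [if_neg ha]
    simp [ha]

/-- The generating function of the partitions without ones and with largest part `L ≥ 2`. -/
theorem card_count_one_eq_zero_and_largestPart_eq {L : ℕ} (hL : 2 ≤ L) (n : ℕ) :
    ((univ.filter fun p : n.Partition => p.parts.count 1 = 0 ∧ largestPart p = L).card : ℤ) =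
    coeff n ((1 - X) * X ^ L * qInv ℤ L) := by
  set N := max n L with hN
  have hnN : n ≤ N := le_max_left _ _
  have hLN : L ≤ N := le_max_right _ _
  -- No ones, nothing above L, L itself at least once, the rest free.
  let φ : ℕ → ℕ → ℤ := fun i c =>
    if i = 1 ∨ L < i then (if c = 0 then 1 else 0) else
      if i = L then (if c = 0 then 0 else 1) else 1
  have h1 := sum_prod_count_eq_coeff φ hnN
  have h2 : ∀ p : n.Partition, ∏ i ∈ Icc 1 N, φ i (p.parts.count i) =
      if p.parts.count 1 = 0 ∧ largestPart p = L then 1 else 0 := by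
    intro p
    split_ifs with h
    · obtain ⟨ha, hb⟩ := h
      refine prod_eq_one fun i hi => ?_
      simp only [φ]
      by_cases hc : i = 1 ∨ L < i
      · rw [if_pos hc, if_pos]
        rcases hc with rfl | hc
        · exact ha
        · rw [Multiset.count_eq_zero]
          intro hd
          have := le_largestPart p hd
          omega
      · rw [if_neg hc]
        split_ifs with hd he
        · exfalso
          subst hd
          have hp : p.parts ≠ 0 := by
            intro hp
            rw [largestPart, hp] at hb
            simp at hb
            omega
          have := largestPart_mem p hp
          rw [hb] at this
          exact Multiset.count_eq_zero.mp he this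
        · rfl
        · rfl
    · by_contra hne
      have hall : ∀ i ∈ Icc 1 N, φ i (p.parts.count i) ≠ 0 :=
        fun i hi h0 => hne (prod_eq_zero hi h0)
      apply h
      have ha : ∀ i ∈ Icc 1 N, i = 1 ∨ L < i → p.parts.count i = 0 := by
        intro i hi hc
        by_contra h0
        refine hall i hi ?_
        simp only [φ]
        rw [if_pos hc, if_neg h0]
      have hb : L ∈ p.parts := by
        by_contra h0
        refine hall L (mem_Icc.mpr ⟨by omega, hLN⟩) ?_
        simp only [φ]
        rw [if_neg (by omega), if_pos trivial, if_pos (Multiset.count_eq_zero.mpr h0)]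
      refine ⟨ha 1 (mem_Icc.mpr ⟨le_rfl, by omega⟩) (Or.inl rfl), le_antisymm ?_
        (le_largestPart p hb)⟩
      by_contra hlt
      have hm := largestPart_mem p (by rintro h0; simp [h0] at hb)
      have := ha (largestPart p) (mem_Icc.mpr
        ⟨p.parts_pos hm, (Nat.Partition.le_of_mem_parts hm).trans hnN⟩) (Or.inr (by omega))
      exact Multiset.count_eq_zero.mp this hm
  have h3 : ∏ i ∈ Icc 1 N, partSeries i (φ i) = (1 - X) * X ^ L * qInv ℤ L := by
    obtain ⟨M, rfl⟩ : ∃ M, L = M + 1 := ⟨L - 1, by omega⟩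
    rw [prod_Icc_one_split _ (by omega) hLN, Finset.prod_Ioc_succ_top (by omega)]
    have hz : ∀ i, 0 < i → i = 1 ∨ M + 1 < i → partSeries i (φ i) = 1 := by
      intro i hi hc
      rw [← partSeries_zero_indicator hi]
      refine congrArg (partSeries i) (funext fun c => ?_)
      simp only [φ]
      rw [if_pos hc]
    have ha : ∏ i ∈ Ioc (M + 1) N, partSeries i (φ i) = 1 := by
      refine prod_eq_one fun i hi => ?_
      have := mem_Ioc.mp hi
      exact hz i (by omega) (by omega)
    have hb : ∏ i ∈ Ioc 1 M, partSeries i (φ i) = (1 - X) * qInv ℤ M := by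
      rw [← prod_Ioc_one_partSeries _ (by omega : 1 ≤ M)]
      refine prod_congr rfl fun i hi => ?_
      have := mem_Ioc.mp hi
      refine congrArg (partSeries i) (funext fun c => ?_)
      simp only [φ]
      rw [if_neg (by omega), if_neg (by omega)]
    have hc : partSeries (M + 1) (φ (M + 1)) =
        X ^ (M + 1) * partSeries (M + 1) (fun _ => (1 : ℤ)) := by
      rw [X_pow_mul_partSeries M.succ_pos]
      refine congrArg (partSeries (M + 1)) (funext fun c => ?_)
      simp only [φ, shiftSeq]
      rw [if_neg (by omega), if_pos trivial]
    rw [hz 1 one_pos (Or.inl rfl), ha, hb, hc, qInv, qInv, prod_range_succ]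
    ring
  rw [← h3, ← h1, Finset.card_filter]
  push_cast
  exact sum_congr rfl fun p _ => (h2 p).symm

theorem card_filter_lt_le {n : ℕ} (p : n.Partition) (w : ℕ) :
    Multiset.card (p.parts.filter (fun a => w < a)) ≤ n := by
  refine (Multiset.card_le_card (Multiset.filter_le _ _)).trans ?_
  have h4 := sum_map_pred_add_card p.parts (fun _ hi => p.parts_pos hi)
  rw [p.parts_sum] at h4
  omega

theorem count_one_le {n : ℕ} (p : n.Partition) : p.parts.count 1 ≤ n := by
  refine (Multiset.count_le_card _ _).trans ?_
  have h4 := sum_map_pred_add_card p.parts (fun _ hi => p.parts_pos hi)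
  rw [p.parts_sum] at h4
  omega

theorem coeff_mul_durfee (c : ℤ⟦X⟧) (m a n : ℕ) :
    coeff n (c * durfee m a) = ∑ w ∈ range (n + 1), coeff n (c * durfeeTerm m a w) := by
  rw [durfee, mul_lsum _ (X_pow_dvd_durfeeTerm _ _), lsum, coeff_mk, map_sum]

/-- The series agrees with the convention M(1,1) = M(-1,1) = 1 in degree 1. -/
theorem coeff_one_crank {m : ℕ} (hm : 1 ≤ m) :
    coeff 1 ((1 - X) * X ^ m * durfee m 2) = if m = 1 then 1 else 0 := by
  rw [mul_comm (1 - X : ℤ⟦X⟧), mul_assoc, coeff_X_pow_mul']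
  split_ifs with h1 h2 h2
  · subst h2
    have : ∀ n, constantCoeff (qInv ℤ n) = 1 := by
      intro n
      rw [qInv, map_prod]
      refine prod_eq_one fun i _ => ?_
      rw [← coeff_zero_eq_constantCoeff_apply, coeff_partSeries]
      simp
    rw [Nat.sub_self, coeff_mul_durfee]
    simp [durfeeTerm, this]
  · omega
  · omega
  · rfl

/-- The w-th term of the Durfee series counts the partitions with w ones: for w ≥ 1 they have w + m
parts larger than w, and for w = 0 the largest part is m. -/
theorem crankCount_natCast {m : ℕ} (hm : 1 ≤ m) (n : ℕ) :
    crankCount m n = coeff n ((1 - X) * X ^ m * durfee m 2) := by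
  rw [crankCount]
  split_ifs with h1 h2 h3 h4
  · exact h2.elim
  · omega
  · subst h1
    rw [coeff_one_crank hm, if_pos (by omega)]
  · subst h1
    rw [coeff_one_crank hm, if_neg (by omega)]
  · rw [Finset.card_eq_sum_card_fiberwise (f := fun p : n.Partition => p.parts.count 1)
      (t := range (n + 1)) (fun p _ => by simpa using Nat.lt_succ_of_le (count_one_le p)),
      coeff_mul_durfee]
    push_cast
    refine sum_congr rfl fun w _ => ?_
    rw [filter_filter]
    rcases Nat.eq_zero_or_pos w with rfl | hw
    · have h2 : (univ.filter fun p : n.Partition => crank p = m ∧ p.parts.count 1 = 0) =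
          univ.filter fun p : n.Partition => p.parts.count 1 = 0 ∧ largestPart p = m := by
        refine filter_congr fun p _ => ?_
        rw [crank]
        constructor
        · rintro ⟨ha, hb⟩
          rw [if_pos hb] at ha
          exact ⟨hb, by exact_mod_cast ha⟩
        · rintro ⟨ha, hb⟩
          rw [if_pos ha, hb]
          exact ⟨rfl, ha⟩
      rw [h2]
      rcases Nat.lt_or_ge m 2 with h3 | h3
      · obtain rfl : m = 1 := by omega
        have h4 : (univ.filter fun p : n.Partition =>
            p.parts.count 1 = 0 ∧ largestPart p = 1) = ∅ := by
          rw [filter_eq_empty_iff]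
          rintro p - ⟨ha, hb⟩
          have hp : p.parts ≠ 0 := by
            intro hp
            rw [largestPart, hp] at hb
            simp at hb
          have := largestPart_mem p hp
          rw [hb] at this
          exact Multiset.count_eq_zero.mp ha this
        have h5 := one_sub_mul_qInv_succ (R := ℤ) 0
        have h6 : (1 - X) * X ^ 1 * durfeeTerm 1 2 0 = X ^ 1 := by
          simp only [durfeeTerm]
          simp only [zero_add, pow_one, qInv_zero] at h5
          simp only [zero_mul, mul_zero, add_zero, pow_zero, one_mul, qInv_zero, zero_add, pow_one]
          linear_combination X * h5
        -- For m = 1 the term w = 0 is just q, though no partition without ones has largest part 1;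
        -- this matters only at n = 1, which the convention covers.
        rw [h4, h6, coeff_X_pow, if_neg h1]
        rfl
      · rw [card_count_one_eq_zero_and_largestPart_eq h3]
        simp [durfeeTerm]
    · have h2 : (univ.filter fun p : n.Partition => crank p = m ∧ p.parts.count 1 = w) =
          univ.filter fun p : n.Partition => p.parts.count 1 = w ∧
            Multiset.card (p.parts.filter (fun a => w < a)) = w + m := by
        refine filter_congr fun p _ => ?_
        rw [crank]
        constructor
        · rintro ⟨ha, rfl⟩
          rw [if_neg (by omega)] at ha
          exact ⟨rfl, by omega⟩
        · rintro ⟨rfl, hb⟩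
          rw [if_neg (by omega)]
          exact ⟨by omega, rfl⟩
      rw [h2, card_count_one_eq_and_card_filter_eq hw, durfeeTerm]
      congr 1
      ring

/-- Now the Durfee index is the number v of parts exceeding the number of ones. There are v + m > 0
ones, so partitions without ones do not interfere. Exchanging the roles of v and w gives the same
series as for crank m. -/
theorem crankCount_neg_natCast {m : ℕ} (hm : 1 ≤ m) (n : ℕ) :
    crankCount (-m) n = coeff n ((1 - X) * X ^ m * durfee m 2) := by
  rw [crankCount]
  split_ifs with h1 h2 h3 h4
  · subst h1
    rw [coeff_one_crank hm, if_pos (by omega)]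
  · omega
  · omega
  · subst h1
    rw [coeff_one_crank hm, if_neg (by omega)]
  · rw [Finset.card_eq_sum_card_fiberwise (f := fun p : n.Partition =>
        Multiset.card (p.parts.filter (fun a => p.parts.count 1 < a)))
      (t := range (n + 1)) (fun p _ => by simpa using Nat.lt_succ_of_le (card_filter_lt_le p _)),
      coeff_mul_durfee]
    push_cast
    refine sum_congr rfl fun v _ => ?_
    rw [filter_filter]
    have h2 : (univ.filter fun p : n.Partition => crank p = -m ∧
          Multiset.card (p.parts.filter (fun a => p.parts.count 1 < a)) = v) =
        univ.filter fun p : n.Partition => p.parts.count 1 = v + m ∧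
          Multiset.card (p.parts.filter (fun a => v + m < a)) = v := by
      refine filter_congr fun p _ => ?_
      rw [crank]
      constructor
      · rintro ⟨ha, hb⟩
        split_ifs at ha with hc
        · omega
        · have hd : p.parts.count 1 = v + m := by omega
          rw [hd] at hb
          exact ⟨hd, hb⟩
      · rintro ⟨ha, hb⟩
        rw [ha, if_neg (by omega)]
        exact ⟨by omega, hb⟩
    rw [h2, card_count_one_eq_and_card_filter_eq (by omega), durfeeTerm,
      mul_comm (qInv ℤ (v + m))]
    congr 1
    ring

theorem sum_crankGeSeries_sub {r n : ℕ} :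
    ∑ m ∈ Icc r n, coeff n (crankGeSeries m - crankGeSeries (m + 1)) =
      coeff n (crankGeSeries r) := by
  have h0 : ∀ M, n < M → coeff n (crankGeSeries M) = 0 := fun M hM =>
    X_pow_dvd_iff.mp (dvd_mul_right _ _) n hM
  rcases Nat.lt_or_ge n r with h | h
  · rw [Icc_eq_empty (by omega), sum_empty, h0 r h]
  · have h1 : ∀ M, r ≤ M → ∑ m ∈ Icc r M, coeff n (crankGeSeries m - crankGeSeries (m + 1)) =
        coeff n (crankGeSeries r) - coeff n (crankGeSeries (M + 1)) := by
      intro M hM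
      induction M, hM using Nat.le_induction with
      | base => simp
      | succ M hM ih => rw [sum_Icc_succ_top (by omega), ih, map_sub]; ring
    rw [h1 n h, h0 (n + 1) n.lt_succ_self, sub_zero]

theorem sum_crankCount {r : ℕ} (hr : 1 ≤ r) (n : ℕ) :
    ∑ m ∈ Icc r n, crankCount m n = coeff n (crankGeSeries r) := by
  rw [← sum_crankGeSeries_sub]
  refine sum_congr rfl fun m hm => ?_
  rw [crankCount_natCast (hr.trans (mem_Icc.mp hm).1), crankGeSeries_sub]

theorem sum_crankCount_neg {r : ℕ} (hr : 1 ≤ r) (n : ℕ) :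
    ∑ m ∈ Icc r n, crankCount (-m) n = coeff n (crankGeSeries r) := by
  rw [← sum_crankGeSeries_sub]
  refine sum_congr rfl fun m hm => ?_
  rw [crankCount_neg_natCast (hr.trans (mem_Icc.mp hm).1), crankGeSeries_sub]

end CrankCount

/-! ### Sums over compositions and increasing indices as coefficients of products -/

section Compositions

/-- Splitting off the first block of a composition. -/
theorem sum_composition_eq {M : Type*} [AddCommMonoid M] (G : List ℕ → M) {k : ℕ} (hk : 1 ≤ k) :
    ∑ c : Composition k, G c.blocks =
      ∑ x ∈ Icc 1 k, ∑ c : Composition (k - x), G (x :: c.blocks) := by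
  rw [Finset.sum_sigma']
  symm
  refine Finset.sum_bij (fun y hy => (⟨y.1 :: y.2.blocks, ?_, ?_⟩ : Composition k)) ?_ ?_ ?_ ?_
  · intro i hi
    have := mem_Icc.mp (mem_sigma.mp hy).1
    rcases List.mem_cons.mp hi with rfl | hi
    · omega
    · exact y.2.blocks_pos hi
  · have := mem_Icc.mp (mem_sigma.mp hy).1
    rw [List.sum_cons, y.2.blocks_sum]
    omega
  · intro _ _; exact mem_univ _
  · rintro ⟨x, c⟩ _ ⟨x', c'⟩ _ h
    have h1 := congrArg Composition.blocks h
    simp only [List.cons.injEq] at h1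
    obtain ⟨rfl, h2⟩ := h1
    rw [Composition.ext h2]
  · intro c _
    obtain ⟨bl, hpos, hsum⟩ := c
    rcases bl with _ | ⟨x, l⟩
    · simp at hsum; omega
    · have hx := hpos (List.mem_cons_self)
      rw [List.sum_cons] at hsum
      refine ⟨⟨x, ⟨l, fun hi => hpos (List.mem_cons_of_mem _ hi), by omega⟩⟩, ?_, rfl⟩
      rw [mem_sigma, mem_Icc]
      exact ⟨⟨hx, by simp only; omega⟩, mem_univ _⟩
  · intro _ _; rfl

/-- The strictly increasing tuples of length `r` with entries in `[a, m]`. -/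
def increasingTuples (r a m : ℕ) : Finset (Fin r → ℕ) :=
  (Fintype.piFinset (fun _ : Fin r => Finset.Icc a m)).filter
    (fun j => ∀ a b : Fin r, a < b → j a < j b)

theorem mem_increasingTuples {r a m : ℕ} {j : Fin r → ℕ} :
    j ∈ increasingTuples r a m ↔ (∀ i, a ≤ j i ∧ j i ≤ m) ∧ ∀ a b : Fin r, a < b → j a < j b := by
  simp [increasingTuples, Fintype.mem_piFinset]

theorem sum_increasingTuples_succ {M : Type*} [AddCommMonoid M] (r a m : ℕ)
    (G : (Fin (r + 1) → ℕ) → M) :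
    ∑ j ∈ increasingTuples (r + 1) a m, G j =
      ∑ x ∈ Icc a m, ∑ j ∈ increasingTuples r (x + 1) m, G (Fin.cons x j) := by
  rw [Finset.sum_sigma']
  symm
  refine Finset.sum_bij' (fun y _ => Fin.cons y.1 y.2) (fun j _ => ⟨j 0, Fin.tail j⟩) ?_ ?_ ?_ ?_ ?_
  · rintro ⟨x, j⟩ hy
    rw [mem_sigma, mem_Icc, mem_increasingTuples] at hy
    obtain ⟨hx, hj, hinc⟩ := hy
    simp only at hx hj hinc
    rw [mem_increasingTuples]
    constructor
    · intro i
      refine Fin.cases ?_ (fun i => ?_) i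
      · simpa using hx
      · have := hj i
        simp only [Fin.cons_succ]
        omega
    · intro a b
      refine Fin.cases ?_ (fun a => ?_) a
      · refine Fin.cases ?_ (fun b => ?_) b
        · simp
        · intro _
          have := hj b
          simp only [Fin.cons_succ, Fin.cons_zero]
          omega
      · refine Fin.cases ?_ (fun b => ?_) b
        · simp
        · intro hab
          simpa using hinc a b (by simpa using hab)
  · intro j hj
    rw [mem_increasingTuples] at hj
    obtain ⟨hj, hinc⟩ := hj
    rw [mem_sigma, mem_Icc, mem_increasingTuples]
    refine ⟨hj 0, fun i => ⟨hinc 0 i.succ (Fin.succ_pos i), (hj i.succ).2⟩, fun a b hab => ?_⟩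
    exact hinc a.succ b.succ (by simpa using hab)
  · rintro ⟨x, j⟩ _
    simp
  · intro j _
    simp
  · intro _ _; rfl

/-- Expansion according to the smallest index x at which f is chosen instead of 1. -/
theorem prod_one_add_Icc {R : Type*} [CommRing R] (f : ℕ → R) (a m : ℕ) :
    ∏ j ∈ Icc a m, (1 + f j) = 1 + ∑ x ∈ Icc a m, f x * ∏ j ∈ Icc (x + 1) m, (1 + f j) := by
  by_cases h : m < a
  · simp [h]
  · have ham : a ≤ m := by omega
    induction ham using Nat.decreasingInduction with
    | self => simp
    | of_succ a ha ih =>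
      have h1 : Icc a m = insert a (Icc (a + 1) m) := by
        ext i; simp only [mem_insert, mem_Icc]; omega
      have h2 : a ∉ Icc (a + 1) m := by simp
      rw [h1, prod_insert h2, sum_insert h2, add_mul, one_mul]
      nth_rewrite 1 [ih (by omega)]
      ring

/-- The sum over all compositions of `k` and all increasing tuples of indices is a coefficient of a
product. -/
theorem sum_composition_increasingTuples (F : ℕ → ℕ → ℤ) (m k a : ℕ) :
    ∑ c : Composition k, ∑ j ∈ increasingTuples c.blocks.length a m,
        ∏ i : Fin c.blocks.length, F (j i) (c.blocks.getD i 0) =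
      coeff k (∏ j ∈ Icc a m, (1 + PowerSeries.mk fun x => if x = 0 then 0 else F j x)) := by
  -- Peel off the first block x and its index y: a composition of k - x remains, with indices
  -- starting at y + 1.
  induction k using Nat.strong_induction_on generalizing a with
  | _ k ih =>
    rcases Nat.eq_zero_or_pos k with rfl | hk
    · have h0 : ∀ c : Composition 0, c.blocks = [] := fun c => c.blocks_eq_nil.mpr rfl
      rw [coeff_zero_eq_constantCoeff_apply, map_prod]
      rw [prod_congr rfl (g := fun _ => 1), prod_const_one]
      · rw [sum_congr rfl (g := fun _ => (1 : ℤ))]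
        · simp [composition_card]
        · intro c _
          rw [h0 c]
          simp [increasingTuples]
      · intro j _
        rw [← coeff_zero_eq_constantCoeff_apply]
        simp
    · rw [sum_composition_eq (fun l => ∑ j ∈ increasingTuples l.length a m,
        ∏ i : Fin l.length, F (j i) (l.getD i 0)) hk, prod_one_add_Icc, map_add, coeff_one,
        if_neg (by omega), zero_add, map_sum]
      have h1 : ∀ x ∈ Icc 1 k, ∑ c : Composition (k - x),
          ∑ j ∈ increasingTuples (x :: c.blocks).length a m,
            ∏ i : Fin (x :: c.blocks).length, F (j i) ((x :: c.blocks).getD i 0) =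
          ∑ y ∈ Icc a m, F y x * coeff (k - x)
            (∏ j ∈ Icc (y + 1) m, (1 + PowerSeries.mk fun x => if x = 0 then 0 else F j x)) := by
        intro x hx
        have hx' := mem_Icc.mp hx
        have h2 : ∀ c : Composition (k - x), ∑ j ∈ increasingTuples (x :: c.blocks).length a m,
            ∏ i : Fin (x :: c.blocks).length, F (j i) ((x :: c.blocks).getD i 0) =
            ∑ y ∈ Icc a m, F y x * ∑ j ∈ increasingTuples c.blocks.length (y + 1) m,
              ∏ i : Fin c.blocks.length, F (j i) (c.blocks.getD i 0) := by
          intro c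
          refine (sum_increasingTuples_succ c.blocks.length a m (fun j => ∏ i :
            Fin (c.blocks.length + 1), F (j i) ((x :: c.blocks).getD i 0))).trans ?_
          refine sum_congr rfl fun y _ => ?_
          rw [mul_sum]
          refine sum_congr rfl fun j _ => ?_
          rw [Fin.prod_univ_succ]
          simp
        rw [sum_congr rfl fun c _ => h2 c, sum_comm]
        refine sum_congr rfl fun y _ => ?_
        rw [← mul_sum, ih (k - x) (by omega)]
      rw [sum_congr rfl h1, sum_comm]
      refine sum_congr rfl fun y _ => ?_
      rw [coeff_mul, Finset.Nat.sum_antidiagonal_eq_sum_range_succ_mk]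
      refine sum_subset_zero_on_sdiff (fun x hx => ?_) (fun x hx => ?_) (fun x hx => ?_)
      · have := mem_Icc.mp hx
        exact mem_range.mpr (by omega)
      · rw [mem_sdiff, mem_range, mem_Icc] at hx
        obtain rfl : x = 0 := by omega
        simp
      · have := mem_Icc.mp hx
        rw [coeff_mk, if_neg (by omega)]

end Compositions

/-! ### The weight ω_k and the generating function of spt_k -/

section Omega

theorem evenWeight_eq (f : ℕ) : evenWeight f =
    1 + PowerSeries.mk fun x => if x = 0 then 0 else ((f + x).choose (2 * x) : ℤ) := by
  ext m
  rw [evenWeight, coeff_mk, map_add, coeff_one, coeff_mk]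
  split_ifs with h
  · simp [h]
  · simp

theorem omega_eq_coeff {k : ℕ} (hk : 1 ≤ k) {n : ℕ} (p : n.Partition) :
    (omega k p : ℤ) = coeff k (oddWeight (freq p 1) *
      ∏ j ∈ Icc 2 (numDistinct p), evenWeight (freq p j)) := by
  -- The weight becomes an opaque function of the list of blocks, so that the first block can be
  -- split off. List positions start at 0, whereas `summand` starts at 1.
  obtain ⟨G, hG⟩ : ∃ G : List ℕ → ℤ, ∀ l, G l =
      ((freq p 1 + l.getD 0 0 - 1).choose (2 * l.getD 0 0 - 1) : ℤ) *
        ∑ j ∈ increasingTuples (l.length - 1) 2 (numDistinct p),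
          ∏ i : Fin (l.length - 1), ((freq p (j i) + l.getD ((i : ℕ) + 1) 0).choose
            (2 * l.getD ((i : ℕ) + 1) 0) : ℤ) := ⟨_, fun _ => rfl⟩
  have h1 : (omega k p : ℤ) = ∑ c : Composition k, G c.blocks := by
    simp only [hG]
    rw [omega]
    push_cast
    rfl
  rw [h1, sum_composition_eq G hk, coeff_mul, Finset.Nat.sum_antidiagonal_eq_sum_range_succ_mk]
  simp only [hG]
  simp only [evenWeight_eq]
  refine sum_subset_zero_on_sdiff (fun x hx => ?_) (fun x hx => ?_) (fun x hx => ?_)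
  · have := mem_Icc.mp hx
    exact mem_range.mpr (by omega)
  · rw [mem_sdiff, mem_range, mem_Icc] at hx
    obtain rfl : x = 0 := by omega
    simp [oddWeight]
  · have := mem_Icc.mp hx
    have h2 := sum_composition_increasingTuples
      (fun j x => ((freq p j + x).choose (2 * x) : ℤ)) (numDistinct p) (k - x) 2
    rw [← h2, oddWeight, coeff_mk, if_neg (by omega), mul_sum]
    rfl

theorem prod_Icc_two_getD {M : Type*} [CommMonoid M] (g : ℕ → M) (a : ℕ) (l : List ℕ) :
    ∏ j ∈ Icc 2 (l.length + 1), g ((a :: l).getD (j - 1) 0) = (l.map g).prod := by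
  have h : Icc 2 (l.length + 1) = (range l.length).map (addRightEmbedding 2) := by
    ext i
    simp only [mem_Icc, mem_map, mem_range, addRightEmbedding_apply]
    constructor
    · intro h
      exact ⟨i - 2, by omega, by omega⟩
    · rintro ⟨b, hb, rfl⟩
      omega
  rw [h, prod_map]
  have h2 : ∀ x, (a :: l).getD (addRightEmbedding 2 x - 1) 0 = l.getD x 0 := fun x => rfl
  simp only [h2]
  clear h h2
  induction l with
  | nil => simp
  | cons b l ih =>
    rw [List.length_cons, prod_range_succ', List.map_cons, List.prod_cons, ← ih, mul_comm]
    simp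

/-- The witness a is the smallest part. Sizes that do not occur have `evenWeight` 1, so the product
over the larger distinct parts extends to all sizes above a. -/
theorem exists_prod_freq_eq {n N : ℕ} (hn : 1 ≤ n) (hN : n ≤ N) (p : n.Partition) :
    ∃ a ∈ Icc 1 N, a ∈ p.parts ∧ (∀ i ∈ p.parts, a ≤ i) ∧
      oddWeight (freq p 1) * ∏ j ∈ Icc 2 (numDistinct p), evenWeight (freq p j) =
        oddWeight (p.parts.count a) * ∏ i ∈ Ioc a N, evenWeight (p.parts.count i) := by
  have hp := parts_ne_zero_of_pos p hn
  have hmem : ∀ i, i ∈ p.parts.toFinset.sort (· ≤ ·) ↔ i ∈ p.parts := by simp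
  have hlen : (p.parts.toFinset.sort (· ≤ ·)).length = numDistinct p := by
    rw [Finset.length_sort, numDistinct]
  have hsorted := Finset.sortedLT_sort p.parts.toFinset
  have hdef : ∀ j, freq p j =
      p.parts.count ((p.parts.toFinset.sort (· ≤ ·)).getD (j - 1) 0) := fun j => rfl
  simp only [hdef, ← hlen]
  generalize p.parts.toFinset.sort (· ≤ ·) = L at *
  rcases L with _ | ⟨a, l⟩
  · exfalso
    obtain ⟨i, hi⟩ := Multiset.exists_mem_of_ne_zero hp
    simpa using (hmem i).mpr hi
  · have hpw := hsorted.pairwise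
    rw [List.pairwise_cons] at hpw
    obtain ⟨hlt, hpw⟩ := hpw
    have ha : a ∈ p.parts := (hmem a).mp List.mem_cons_self
    refine ⟨a, mem_Icc.mpr ⟨p.parts_pos ha, (Nat.Partition.le_of_mem_parts ha).trans hN⟩, ha,
      fun i hi => ?_, ?_⟩
    · rcases List.mem_cons.mp ((hmem i).mpr hi) with rfl | h
      · exact le_rfl
      · exact (hlt i h).le
    · rw [List.length_cons, prod_Icc_two_getD (fun x => evenWeight (p.parts.count x)),
        ← List.prod_toFinset _ (hpw.imp fun h => h.ne)]
      refine congrArg₂ (· * ·) rfl ?_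
      refine prod_subset_one_on_sdiff (fun i hi => ?_) (fun i hi => ?_) (fun i _ => rfl)
      · have hi' := List.mem_toFinset.mp hi
        have := (hmem i).mp (List.mem_cons_of_mem _ hi')
        exact mem_Ioc.mpr ⟨hlt i hi', (Nat.Partition.le_of_mem_parts this).trans hN⟩
      · rw [mem_sdiff, mem_Ioc, List.mem_toFinset] at hi
        rw [Multiset.count_eq_zero.mpr, evenWeight_zero]
        intro h
        rcases List.mem_cons.mp ((hmem i).mpr h) with rfl | h
        · omega
        · exact hi.2 h

/-- The local factors whose product is the weight of the partitions with smallest part `a`. -/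
noncomputable def sptFactor (a i c : ℕ) : ℤ⟦X⟧ :=
  if i < a then (if c = 0 then 1 else 0) else if i = a then oddWeight c else evenWeight c

theorem prod_Icc_one_split_at {M : Type*} [CommMonoid M] (f : ℕ → M) {a N : ℕ}
    (ha : a ∈ Icc 1 N) :
    ∏ i ∈ Icc 1 N, f i = (∏ i ∈ Ico 1 a, f i) * (f a * ∏ i ∈ Ioc a N, f i) := by
  rw [mem_Icc] at ha
  rw [Finset.mul_prod_Ioc_eq_prod_Icc ha.2]
  have : Icc 1 N = Ico 1 a ∪ Icc a N := by
    ext i; simp only [mem_union, mem_Icc, mem_Ico]; omega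
  rw [this, prod_union]
  rw [Finset.disjoint_left]
  intro i hi hi'
  rw [mem_Ico] at hi
  rw [mem_Icc] at hi'
  omega

/-- Only b = a contributes: for b < a the part b is absent and `oddWeight` is 0, and for b > a the
part a is present but forbidden. -/
theorem sum_prod_sptFactor {n N : ℕ} (p : n.Partition) {a : ℕ} (haN : a ∈ Icc 1 N)
    (ha : a ∈ p.parts) (hmin : ∀ i ∈ p.parts, a ≤ i) :
    ∑ b ∈ Icc 1 N, ∏ i ∈ Icc 1 N, sptFactor b i (p.parts.count i) =
      oddWeight (p.parts.count a) * ∏ i ∈ Ioc a N, evenWeight (p.parts.count i) := by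
  rw [sum_eq_single_of_mem a haN]
  · rw [prod_Icc_one_split_at _ haN, prod_eq_one, one_mul]
    · refine congrArg₂ (· * ·) (by simp [sptFactor]) (prod_congr rfl fun i hi => ?_)
      have := mem_Ioc.mp hi
      rw [sptFactor, if_neg (by omega), if_neg (by omega)]
    · intro i hi
      have := mem_Ico.mp hi
      rw [sptFactor, if_pos (by omega), if_pos]
      rw [Multiset.count_eq_zero]
      intro h
      have := hmin i h
      omega
  · intro b hb hba
    rcases lt_or_gt_of_ne hba with h | h
    · refine prod_eq_zero hb ?_
      rw [sptFactor, if_neg (by omega), if_pos rfl, Multiset.count_eq_zero.mpr, oddWeight_zero]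
      intro h'
      have := hmin b h'
      omega
    · refine prod_eq_zero haN ?_
      rw [sptFactor, if_pos h, if_neg]
      exact fun h' => Multiset.count_eq_zero.mp h' ha

theorem sum_prod_partSeries_sptFactor (N : ℕ) :
    ∑ a ∈ Icc 1 N, ∏ i ∈ Icc 1 N, partSeries i (sptFactor a i) = sptSeries N := by
  refine sum_congr rfl fun a ha => ?_
  rw [prod_Icc_one_split_at _ ha, prod_eq_one, one_mul]
  · refine congrArg₂ (· * ·) ?_ (prod_congr rfl fun i hi => ?_)
    · refine congrArg (partSeries a) (funext fun c => ?_)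
      simp [sptFactor]
    · have := mem_Ioc.mp hi
      refine congrArg (partSeries i) (funext fun c => ?_)
      rw [sptFactor, if_neg (by omega), if_neg (by omega)]
  · intro i hi
    have := mem_Ico.mp hi
    rw [← partSeries_zero_indicator (by omega : 0 < i)]
    refine congrArg (partSeries i) (funext fun c => ?_)
    rw [sptFactor, if_pos (by omega)]

/-- The generating function of the higher order spt-functions. -/
theorem spt_eq_coeff {k n N : ℕ} (hk : 1 ≤ k) (hn : 1 ≤ n) (hN : n ≤ N) :
    (spt k n : ℤ) = coeff k (coeff n (sptSeries N)) := by
  rw [← sum_prod_partSeries_sptFactor, map_sum]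
  simp only [← sum_prod_count_eq_coeff _ hN]
  rw [sum_comm, map_sum, spt]
  push_cast
  refine sum_congr rfl fun p _ => ?_
  obtain ⟨a, haN, ha, hmin, h⟩ := exists_prod_freq_eq hn hN p
  rw [omega_eq_coeff hk, h, sum_prod_sptFactor p haN ha hmin]

end Omega

/-! ### Symmetrized moments by summation by parts -/

section Moments

theorem sum_Icc_neg_eq {M : Type*} [AddCommGroup M] (h : ℤ → M) (n : ℕ) :
    ∑ m ∈ Icc (-(n : ℤ)) n, h m = h 0 + ∑ m ∈ Icc 1 n, (h m + h (-m)) := by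
  induction n with
  | zero => simp
  | succ n ih =>
    have h1 : Icc (-((n + 1 : ℕ) : ℤ)) ((n + 1 : ℕ) : ℤ) =
        insert ((n + 1 : ℕ) : ℤ) (insert (-((n + 1 : ℕ) : ℤ)) (Icc (-(n : ℤ)) n)) := by
      ext i; simp only [mem_insert, mem_Icc]; omega
    rw [h1, sum_insert, sum_insert, ih, sum_Icc_succ_top (by omega)]
    · abel
    · simp
    · simp only [mem_insert, mem_Icc]; omega

/-- The coefficient `binom(r + k - 1, 2 k - 1)` in `oddWeight r`. -/
theorem coeff_oddWeight {k : ℕ} (hk : 1 ≤ k) (r : ℕ) :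
    coeff k (oddWeight r) = ((r + k - 1).choose (2 * k - 1) : ℤ) := by
  rw [oddWeight, coeff_mk, if_neg (by omega)]

/-- The hockey-stick identity. -/
theorem choose_eq_sum_oddWeight {k : ℕ} (hk : 1 ≤ k) (m : ℕ) :
    ((m + k).choose (2 * k) : ℤ) = ∑ r ∈ Icc 1 m, coeff k (oddWeight r) := by
  induction m with
  | zero =>
    rw [Nat.choose_eq_zero_of_lt (by omega)]
    simp
  | succ m ih =>
    rw [sum_Icc_succ_top (by omega), ← ih, coeff_oddWeight hk]
    obtain ⟨j, rfl⟩ := Nat.exists_eq_add_of_le' hk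
    have := Nat.choose_succ_succ' (m + (j + 1)) (2 * j + 1)
    rw [show m + 1 + (j + 1) = m + (j + 1) + 1 by ring, show 2 * (j + 1) = 2 * j + 1 + 1 by ring,
      this, show 2 * j + 1 + 1 - 1 = 2 * j + 1 by omega, Nat.add_sub_cancel]
    push_cast
    ring

/-- The floor is k - 1, so the binomial is binom((m-1)+k, 2k); hence the shift to r - 1, absent for
negative arguments. -/
theorem choose_natCast_add {k : ℕ} (hk : 1 ≤ k) {m : ℕ} (hm : 1 ≤ m) :
    Ring.choose ((m : ℤ) + (((2 * k : ℕ) : ℤ) - 1) / 2) (2 * k) =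
      ∑ r ∈ Icc 1 m, coeff k (oddWeight (r - 1)) := by
  rw [show (m : ℤ) + (((2 * k : ℕ) : ℤ) - 1) / 2 = ((m - 1 + k : ℕ) : ℤ) by omega,
    Ring.choose_natCast]
  refine (choose_eq_sum_oddWeight hk (m - 1)).trans ?_
  have h : ∑ r ∈ Icc 1 m, coeff k (oddWeight (r - 1)) =
      ∑ r ∈ range m, coeff k (oddWeight r) := by
    rw [Finset.range_eq_Ico, Finset.sum_Ico_eq_sum_range, ← Finset.Ico_add_one_right_eq_Icc,
      Finset.sum_Ico_eq_sum_range]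
    simp
  obtain ⟨j, rfl⟩ := Nat.exists_eq_add_of_le' hm
  rw [h, Finset.sum_range_succ', oddWeight_zero, map_zero, add_zero, Nat.add_sub_cancel,
    ← Finset.Ico_add_one_right_eq_Icc, Finset.sum_Ico_eq_sum_range]
  simp [add_comm]

theorem choose_neg_natCast_add {k : ℕ} (hk : 1 ≤ k) (m : ℕ) :
    Ring.choose (-(m : ℤ) + (((2 * k : ℕ) : ℤ) - 1) / 2) (2 * k) =
      ∑ r ∈ Icc 1 m, coeff k (oddWeight r) := by
  rw [show -(m : ℤ) + (((2 * k : ℕ) : ℤ) - 1) / 2 = -((m : ℤ) - k + 1) by omega,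
    Ring.choose_neg, show ((2 * k : ℕ) : ℤ) = 2 * (k : ℤ) by push_cast; ring,
    Int.negOnePow_two_mul, one_smul,
    show (m : ℤ) - k + 1 + 2 * (k : ℤ) - 1 = ((m + k : ℕ) : ℤ) by push_cast; ring,
    Ring.choose_natCast]
  exact choose_eq_sum_oddWeight hk m

theorem sum_Icc_sum_mul_comm (f g : ℕ → ℤ) (n : ℕ) :
    ∑ m ∈ Icc 1 n, (∑ r ∈ Icc 1 m, f r) * g m = ∑ r ∈ Icc 1 n, f r * ∑ m ∈ Icc r n, g m := by
  simp only [sum_mul, mul_sum]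
  refine Finset.sum_comm' fun m r => ?_
  simp only [mem_Icc]
  omega

/-- A symmetrized moment in terms of the tails of the counted statistic. -/
theorem sum_choose_mul_eq {k : ℕ} (hk : 1 ≤ k) (n : ℕ) (g : ℤ → ℤ) :
    ∑ m ∈ Icc (-(n : ℤ)) (n : ℤ),
        Ring.choose (m + (((2 * k : ℕ) : ℤ) - 1) / 2) (2 * k) * g m =
      ∑ r ∈ Icc 1 n, (coeff k (oddWeight (r - 1)) * ∑ m ∈ Icc r n, g m +
        coeff k (oddWeight r) * ∑ m ∈ Icc r n, g (-m)) := by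
  rw [sum_Icc_neg_eq]
  have h0 := choose_neg_natCast_add hk 0
  simp only [Nat.cast_zero, neg_zero] at h0
  rw [h0]
  simp only [zero_lt_one, Icc_eq_empty_of_lt, sum_empty, zero_mul, zero_add]
  rw [sum_add_distrib, sum_add_distrib, ← sum_Icc_sum_mul_comm (fun r => coeff k (oddWeight r))
    (fun m => g (-m)), ← sum_Icc_sum_mul_comm (fun r => coeff k (oddWeight (r - 1)))
    (fun m => g m)]
  refine congrArg₂ (· + ·) (sum_congr rfl fun m hm => ?_) (sum_congr rfl fun m _ => ?_)
  · rw [choose_natCast_add hk (mem_Icc.mp hm).1]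
  · rw [choose_neg_natCast_add hk]

theorem sum_rankCount {r : ℕ} (n : ℕ) :
    ∑ m ∈ Icc r n, rankCount m n = coeff n (rankGeSeries r) := by
  rw [rankGeSeries, coeff_mk, rankGe, Finset.card_eq_sum_card_fiberwise
    (f := fun p : n.Partition => (rank p).toNat) (t := Icc r n)]
  · push_cast
    refine sum_congr rfl fun m hm => ?_
    have := mem_Icc.mp hm
    rw [rankCount, filter_filter]
    refine congrArg (fun s : Finset n.Partition => (s.card : ℤ)) (filter_congr fun p _ => ?_)
    omega
  · intro p hp
    have h1 : (r : ℤ) ≤ rank p := by simpa using hp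
    have := abs_rank_le p
    simp only [coe_Icc, Set.mem_Icc]
    omega

theorem sum_rankCount_neg {r : ℕ} (n : ℕ) :
    ∑ m ∈ Icc r n, rankCount (-m) n = coeff n (rankLeSeries r) := by
  rw [rankLeSeries, coeff_mk, rankLe, Finset.card_eq_sum_card_fiberwise
    (f := fun p : n.Partition => (-rank p).toNat) (t := Icc r n)]
  · push_cast
    refine sum_congr rfl fun m hm => ?_
    have := mem_Icc.mp hm
    rw [rankCount, filter_filter]
    refine congrArg (fun s : Finset n.Partition => (s.card : ℤ)) (filter_congr fun p _ => ?_)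
    omega
  · intro p hp
    have h1 : rank p ≤ -(r : ℤ) := by simpa using hp
    have := abs_rank_le p
    simp only [coe_Icc, Set.mem_Icc]
    omega

end Moments

/-! ### Iterated recurrences, and comparison of moments with the spt series -/

section Appell

/-- The recurrence substituted into itself J times, with its remainder; for J > n the remainder does
not reach degree n. -/
theorem eq_sum_of_recurrence {R : Type*} [CommRing R] (P : R⟦X⟧) {G : ℕ → R⟦X⟧} {e c : ℕ}
    (hG : ∀ r, 0 < r → G r = X ^ (r + e) * (P - G (r + c))) (J : ℕ) {r : ℕ} (hr : 0 < r) :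
    G r = P * ∑ j ∈ range J,
        (-1) ^ j * X ^ (c * (j + 1).choose 2 + e * (j + 1)) * X ^ ((j + 1) * r) +
      (-1) ^ J * X ^ (J * r + e * J + c * J.choose 2) * G (r + c * J) := by
  induction J with
  | zero => simp
  | succ J ih =>
    rw [sum_range_succ, ih]
    nth_rewrite 1 [hG (r + c * J) (by omega)]
    have h1 : (J + 1).choose 2 = J.choose 2 + J := by
      rw [Nat.choose_succ_succ' J 1, Nat.choose_one_right, add_comm]
    rw [h1, show r + c * J + c = r + c * (J + 1) by ring]
    ring

theorem X_pow_dvd_partSeries_sub {R : Type*} [CommRing R] {i : ℕ} (hi : 0 < i) {a : ℕ → R}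
    (h0 : a 0 = 0) (n : ℕ) :
    X ^ (n + 1) ∣ partSeries i a - ∑ r ∈ Icc 1 n, C (a r) * X ^ (i * r) := by
  rw [X_pow_dvd_iff]
  intro m hm
  rw [map_sub, map_sum, coeff_partSeries, sub_eq_zero]
  simp only [coeff_C_mul, coeff_X_pow]
  split_ifs with h
  · obtain ⟨c, rfl⟩ := h
    rw [Nat.mul_div_cancel_left _ hi]
    rcases Nat.eq_zero_or_pos c with rfl | hc
    · rw [h0, sum_eq_zero]
      intro r hr
      have := mem_Icc.mp hr
      rw [if_neg, mul_zero]
      rw [mul_zero]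
      exact (Nat.mul_pos hi this.1).ne
    · have hcn : c ≤ n := (Nat.le_mul_of_pos_left c hi).trans (by omega)
      rw [sum_eq_single_of_mem c (mem_Icc.mpr ⟨hc, hcn⟩)]
      · simp
      · intro r _ hrc
        rw [if_neg, mul_zero]
        intro h
        exact hrc (Nat.eq_of_mul_eq_mul_left hi h).symm
  · rw [sum_eq_zero]
    intro r _
    rw [if_neg, mul_zero]
    rintro rfl
    exact h (dvd_mul_right i r)

/-- The sequence `binom(r + k - 1, 2 k - 1) + binom(r + k - 2, 2 k - 1)`. -/
noncomputable def appellSeq (k r : ℕ) : ℤ :=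
  coeff k (oddWeight r) + shiftSeq (fun s => coeff k (oddWeight s)) r

/-- Expand each tail and exchange the sums: for fixed j, the sum over r of `appellSeq k r` times
q^((j+1)r) is a `partSeries` at j + 1. -/
theorem sum_appellSeq_mul_coeff {G : ℕ → ℤ⟦X⟧} {e c : ℕ}
    (hG : ∀ r, 0 < r → G r = X ^ (r + e) * (partitionSeries ℤ - G (r + c))) (k n : ℕ) :
    ∑ r ∈ Icc 1 n, appellSeq k r * coeff n (G r) =
      coeff n (partitionSeries ℤ * ∑ j ∈ range (n + 1),
        (-1) ^ j * X ^ (c * (j + 1).choose 2 + e * (j + 1)) *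
          partSeries (j + 1) (appellSeq k)) := by
  have h1 : ∀ r ∈ Icc 1 n, appellSeq k r * coeff n (G r) =
      coeff n (partitionSeries ℤ * ∑ j ∈ range (n + 1),
        (-1) ^ j * X ^ (c * (j + 1).choose 2 + e * (j + 1)) *
          (C (appellSeq k r) * X ^ ((j + 1) * r))) := by
    intro r hr
    have hr' := (mem_Icc.mp hr).1
    rw [eq_sum_of_recurrence (partitionSeries ℤ) hG (n + 1) hr', map_add, mul_add]
    have h2 : coeff n ((-1) ^ (n + 1) *
        X ^ ((n + 1) * r + e * (n + 1) + c * (n + 1).choose 2) * G (r + c * (n + 1))) = 0 := by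
      refine X_pow_dvd_iff.mp (Dvd.dvd.mul_right (Dvd.dvd.mul_left
        (pow_dvd_pow _ (?_ : n + 1 ≤ _)) _) _) n n.lt_succ_self
      have : n + 1 ≤ (n + 1) * r := Nat.le_mul_of_pos_right _ hr'
      omega
    rw [h2, mul_zero, add_zero, ← coeff_C_mul]
    congr 1
    rw [mul_left_comm, mul_sum]
    refine congrArg _ (sum_congr rfl fun j _ => ?_)
    ring
  rw [sum_congr rfl h1, ← map_sum, ← mul_sum, sum_comm]
  symm
  refine coeff_eq_of_X_pow_dvd_sub (m := n + 1) ?_ n.lt_succ_self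
  rw [← mul_sub, ← sum_sub_distrib]
  refine Dvd.dvd.mul_left (dvd_sum fun j _ => ?_) _
  rw [← mul_sum, ← mul_sub]
  refine Dvd.dvd.mul_left (X_pow_dvd_partSeries_sub j.succ_pos ?_ n) _
  simp [appellSeq, shiftSeq]

theorem appellSeq_of_pos (k : ℕ) {r : ℕ} (hr : 1 ≤ r) :
    appellSeq k r = coeff k (oddWeight (r - 1)) + coeff k (oddWeight r) := by
  rw [appellSeq, shiftSeq, if_neg (by omega), add_comm]

theorem mu_eq_coeff {k : ℕ} (hk : 1 ≤ k) (n : ℕ) :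
    mu (2 * k) n = coeff n (partitionSeries ℤ * ∑ j ∈ range (n + 1),
      (-1) ^ j * X ^ ((j + 1).choose 2) * partSeries (j + 1) (appellSeq k)) := by
  have h := sum_appellSeq_mul_coeff (G := crankGeSeries) (e := 0) (c := 1)
    (fun r _ => crankGeSeries_eq r) k n
  simp only [one_mul, zero_mul, add_zero] at h
  rw [mu, sum_choose_mul_eq hk n (fun m => crankCount m n), ← h]
  refine sum_congr rfl fun r hr => ?_
  have hr' := (mem_Icc.mp hr).1
  rw [sum_crankCount hr', sum_crankCount_neg hr', appellSeq_of_pos k hr', add_mul]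

/-- Symmetry of the rank without conjugation: both families satisfy the same recurrence, which
determines them. -/
theorem rankLeSeries_eq_rankGeSeries {r : ℕ} (hr : 0 < r) (n : ℕ) :
    coeff n (rankLeSeries r) = coeff n (rankGeSeries r) := by
  have h1 := eq_sum_of_recurrence (partitionSeries ℤ) (G := rankLeSeries) (e := 1) (c := 3)
    (fun r => rankLeSeries_eq) (n + 1) hr
  have h2 := eq_sum_of_recurrence (partitionSeries ℤ) (G := rankGeSeries) (e := 1) (c := 3)
    (fun r => rankGeSeries_eq) (n + 1) hr
  refine coeff_eq_of_X_pow_dvd_sub (m := n + 1) ?_ n.lt_succ_self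
  rw [h1, h2, add_sub_add_left_eq_sub, ← mul_sub]
  refine Dvd.dvd.mul_right (Dvd.dvd.mul_left (pow_dvd_pow _ ?_) _) _
  have : n + 1 ≤ (n + 1) * r := Nat.le_mul_of_pos_right _ hr
  omega

theorem eta_eq_coeff {k : ℕ} (hk : 1 ≤ k) (n : ℕ) :
    eta (2 * k) n = coeff n (partitionSeries ℤ * ∑ j ∈ range (n + 1),
      (-1) ^ j * X ^ (3 * (j + 1).choose 2 + (j + 1)) * partSeries (j + 1) (appellSeq k)) := by
  have h := sum_appellSeq_mul_coeff (G := rankGeSeries) (e := 1) (c := 3)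
    (fun r => rankGeSeries_eq) k n
  simp only [one_mul] at h
  rw [eta, sum_choose_mul_eq hk n (fun m => rankCount m n), ← h]
  refine sum_congr rfl fun r hr => ?_
  have hr' := (mem_Icc.mp hr).1
  rw [sum_rankCount, sum_rankCount_neg, rankLeSeries_eq_rankGeSeries hr', appellSeq_of_pos k hr',
    add_mul]

theorem coeff_coeff_map_C_mul (F : ℤ⟦X⟧) (f : ℤ⟦X⟧⟦X⟧) (k n : ℕ) :
    coeff k (coeff n (PowerSeries.map C F * f)) =
      coeff n (F * PowerSeries.mk fun m => coeff k (coeff m f)) := by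
  rw [coeff_mul, coeff_mul, map_sum]
  refine sum_congr rfl fun x _ => ?_
  rw [coeff_map, coeff_C_mul, coeff_mk]

theorem map_partitionSeries {R S : Type*} [CommRing R] [CommRing S] (f : R →+* S) :
    PowerSeries.map f (partitionSeries R) = partitionSeries S := by
  ext n
  simp [partitionSeries]

/-- The partition series and α are free of s, so taking the coefficient of s^k acts only on the odd
series; the factor 1 + q^(j+1) of α turns that coefficient into `appellSeq`. -/
theorem coeff_coeff_partitionSeries_mul_sum (k n : ℕ) :
    coeff k (coeff n (partitionSeries ℤ⟦X⟧ *
        ∑ r ∈ range (n + 1), baileyAlpha ℤ⟦X⟧ r * partSeries (r + 1) oddWeight)) =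
      coeff n (partitionSeries ℤ * ∑ j ∈ range (n + 1),
        (-1) ^ j * (X ^ ((j + 1).choose 2) - X ^ (3 * (j + 1).choose 2 + (j + 1))) *
          partSeries (j + 1) (appellSeq k)) := by
  rw [mul_sum, mul_sum, map_sum, map_sum, map_sum]
  refine sum_congr rfl fun j _ => ?_
  have h1 : partitionSeries ℤ⟦X⟧ * (baileyAlpha ℤ⟦X⟧ j * partSeries (j + 1) oddWeight) =
      PowerSeries.map C (partitionSeries ℤ * baileyAlpha ℤ j) * partSeries (j + 1) oddWeight := by
    rw [map_mul, map_partitionSeries, baileyAlpha, baileyAlpha]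
    simp only [map_mul, map_sub, map_add, map_pow, map_neg, map_one, map_X]
    ring
  have h2 : (PowerSeries.mk fun m => coeff k (coeff m (partSeries (j + 1) oddWeight))) =
      partSeries (j + 1) (fun c => coeff k (oddWeight c)) := by
    ext m
    rw [coeff_mk, coeff_partSeries, coeff_partSeries]
    split_ifs <;> simp
  have h3 : (1 + X ^ (j + 1)) * partSeries (j + 1) (fun c => coeff k (oddWeight c)) =
      partSeries (j + 1) (appellSeq k) := by
    rw [add_mul, one_mul, X_pow_mul_partSeries j.succ_pos, partSeries_add]
    rfl
  rw [h1, coeff_coeff_map_C_mul, h2, ← h3, baileyAlpha]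
  congr 1
  ring

end Appell

end SptMoments

theorem mainTheorem3 (k n : ℕ) (hk : 1 ≤ k) (hn : 1 ≤ n) :
    (SptMoments.spt k n : ℤ) = SptMoments.mu (2 * k) n - SptMoments.eta (2 * k) n := by
  -- The bound N = n + 1 on the parts gives the spt sum the same range as the two moment sums.
  rw [SptMoments.spt_eq_coeff hk hn n.le_succ, SptMoments.coeff_sptSeries n.le_succ,
    SptMoments.coeff_coeff_partitionSeries_mul_sum, SptMoments.mu_eq_coeff hk,
    SptMoments.eta_eq_coeff hk, ← map_sub, ← mul_sub, ← Finset.sum_sub_distrib]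
  simp only [mul_sub, sub_mul]
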